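/- **Setting.** Let $G=(V,E)$ be a triangulated Laman graph, i.e. a finite graph obtained from a single edge on two vertices by repeatedly adding a new vertex joined by two new edges to the two end vertices of an existing edge (such a sequence of additions is a Henneberg construction of $G$). For every edge $(i,j)\in E$ let $f_{ij}=f_{ji}\in\mathcal U$, where $\mathcal U$ is the set of $f\in C^1((0,\infty),\mathbb R)$ such that $\frac{d}{dx}(xf(x))>0$ for all $x>0$, $f$ has a unique zero, and $\lim_{x\to0^+}\int_x^1 tf(t)\,dt=-\infty$. On the configuration space $P_G=\{p=(x_i)_{i\in V}\in(\mathbb R^2)^V : x_i\ne x_j \text{ for all } (i,j)\in E\}$ consider the formation dynamics $$\dot x_i=\sum_{j:(i,j)\in E}f_{ij}(\|x_i-x_j\|)\,(x_j-x_i),\qquad i\in V,$$ with potential $\Phi(p)=\sum_{(i,j)\in E}\int_1^{\|x_i-x_j\|}tf_{ij}(t)\,dt$. Let $\mathcal O_p$ be the orbit of $p\in P_G$ under the action of $SE(2)$ (the same rotation and translation applied to all $x_i$). It is a *critical orbit* if $\nabla\Phi(p)=0$. A critical orbit is *nondegenerate* if the Hessian matrix of $\Phi$ at $p$ has exactly three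 zero eigenvalues, counted with multiplicity. It is *exponentially stable* if there are $\delta,C,r>0$ such that every solution $x(t)$ of the dynamics in $P_G$ with $\operatorname{dist}(x(0),\mathcal O_p)<\delta$ satisfies $\operatorname{dist}(x(t),\mathcal O_p)\le Ce^{-rt}\operatorname{dist}(x(0),\mathcal O_p)$ for all $t\ge 0$ at which it is defined. The *independent partition* $E=E_1\cup\dots\cup E_m$ associated with $(G,p)$ is built along a Henneberg construction of $G$. Start with the one class consisting of the initial edge. When a vertex $v$ is joined to the end vertices of an edge $(j,k)$, then: if $x_j,x_k,x_v$ are collinear, add $(j,v)$ and $(k,v)$ to the class containing $(j,k)$; otherwise add the two new classes $\{(j,v)\}$ and $\{(k,v)\}$. Let $V_i$ be the set of vertices incident to edges in $E_i$, let $G_i=(V_i,E_i)$, and let $p_i$ be the restriction of $p$ to $V_i$. The notions above are applied to $p_i$ with respect to the subsystem induced by $G_i$, i.e. with agents $V_i$, edges $E_i$, and the same interaction laws. **Statement.** Let $\mathcal O_p$, $p\in P_G$, be a critical orbit. Then, for the independent partition obtained from any Henneberg construction of $G$, each $\mathcal O_{p_i}$ is a critical orbit of the subsystem induced by $G_i$,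 and 1. $\mathcal O_p$ is nondegenerate if and only if each $\mathcal O_{p_i}$, $i=1,\dots,m$, is nondegenerate; 2. $\mathcal O_p$ is exponentially stable if and only if each $\mathcal O_{p_i}$, $i=1,\dots,m$, is exponentially stable. -/

import Mathlib

open Set Filter Topology

noncomputable section

namespace Formation

universe u

/-- The plane in which the agents move, with its Euclidean norm. -/
abbrev Plane : Type := EuclideanSpace ℝ (Fin 2)

/-! ### Interaction laws, configurations and dynamics -/

/-- The class `𝓤` of interaction laws. A law is a function on `(0, ∞)`; values of `f` at
nonpositive arguments are irrelevant. -/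
structure IsInteractionLaw (f : ℝ → ℝ) : Prop where
  contDiffOn : ContDiffOn ℝ 1 f (Ioi 0)
  deriv_pos : ∀ x : ℝ, 0 < x → 0 < deriv (fun y => y * f y) x
  existsUnique_zero : ∃! x : ℝ, 0 < x ∧ f x = 0
  tendsto_integral : Tendsto (fun x : ℝ => ∫ t in x..1, t * f t) (𝓝[>] 0) atBot

section System

variable {V : Type u}

/-- The configuration space `P_G`: adjacent vertices have distinct positions. -/
def configSpace (G : SimpleGraph V) : Set (V → Plane) :=
  {p | ∀ i j, G.Adj i j → p i ≠ p j}

/-- The length of the (potential) edge `e` in the configuration `p`. -/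
def edgeLength (p : V → Plane) (e : Sym2 V) : ℝ :=
  Sym2.lift ⟨fun i j => dist (p i) (p j), fun i j => dist_comm (p i) (p j)⟩ e

/-- The orbit of the configuration `p` under the action of `SE(2)`. -/
def orbit (p : V → Plane) : Set (V → Plane) :=
  {q | ∃ θ ∈ Matrix.specialOrthogonalGroup (Fin 2) ℝ, ∃ w : Plane,
    ∀ i, q i = Matrix.toEuclideanLin θ (p i) + w}

variable [Fintype V]

open Classical in
/-- The potential function `Φ(p) = ∑_{e ∈ E} ∫_1^{d_e} t f_e(t) dt`. -/
def potential (G : SimpleGraph V) (f : Sym2 V → ℝ → ℝ) (p : V → Plane) : ℝ :=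
  ∑ e : Sym2 V with e ∈ G.edgeSet, ∫ t in (1 : ℝ)..edgeLength p e, t * f e t

open Classical in
/-- The right-hand side of the equations of motion
`ẋ_i = ∑_{j ∼ i} f_{ij}(d_{ij}) (x_j - x_i)`. -/
def vectorField (G : SimpleGraph V) (f : Sym2 V → ℝ → ℝ) (p : V → Plane) : V → Plane :=
  fun i => ∑ j : V with G.Adj i j, f s(i, j) (dist (p i) (p j)) • (p j - p i)

/-- The orbit of `p` is a critical orbit: `p ∈ P_G` and the first derivative of `Φ` vanishes
at `p`. -/
def IsCriticalOrbit (G : SimpleGraph V) (f : Sym2 V → ℝ → ℝ) (p : V → Plane) : Prop :=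
  p ∈ configSpace G ∧ fderiv ℝ (potential G f) p = 0

open Classical in
/-- The standard basis vector of `(ℝ²)^V` for the `a.2`-th coordinate of agent `a.1`. -/
def coordVec (a : V × Fin 2) : V → Plane :=
  Pi.single a.1 (EuclideanSpace.single a.2 (1 : ℝ))

/-- The Hessian matrix of the potential function at `p`, of size `2|V|`. -/
def hessian (G : SimpleGraph V) (f : Sym2 V → ℝ → ℝ) (p : V → Plane) :
    Matrix (V × Fin 2) (V × Fin 2) ℝ :=
  Matrix.of fun a b =>
    fderiv ℝ (fun q => fderiv ℝ (potential G f) q (coordVec b)) p (coordVec a)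

open Classical in
/-- The number `n₀` of zero eigenvalues of a real symmetric matrix, with multiplicity. -/
def zeroEigenvalueCount {n : Type u} [Fintype n] (H : Matrix n n ℝ) : ℕ :=
  H.charpoly.roots.count 0

/-- Nondegeneracy of a critical orbit: the Hessian has exactly three zero eigenvalues. -/
def IsNondegenerate (G : SimpleGraph V) (f : Sym2 V → ℝ → ℝ) (p : V → Plane) : Prop :=
  zeroEigenvalueCount (hessian G f p) = 3

/-- `x` solves the equations of motion in `P_G` on the time interval `[0, T)`. -/
def IsSolutionOn (G : SimpleGraph V) (f : Sym2 V → ℝ → ℝ) (x : ℝ → V → Plane) (T : ℝ) : Prop :=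
  ∀ t ∈ Ico 0 T, x t ∈ configSpace G ∧
    HasDerivWithinAt x (vectorField G f (x t)) (Ico 0 T) t

/-- Exponential stability of the orbit of `p` for the formation dynamics: solutions that start
close to the orbit approach it exponentially fast, as long as they exist. The distance is that of
the norm `max_i ‖x_i‖`; the notion is the same for every norm on `(ℝ²)^V`. -/
def IsExponentiallyStable (G : SimpleGraph V) (f : Sym2 V → ℝ → ℝ) (p : V → Plane) : Prop :=
  ∃ δ > (0 : ℝ), ∃ C > (0 : ℝ), ∃ r > (0 : ℝ), ∀ T > (0 : ℝ), ∀ x : ℝ → V → Plane,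
    IsSolutionOn G f x T → Metric.infDist (x 0) (orbit p) < δ →
      ∀ t ∈ Ico 0 T,
        Metric.infDist (x t) (orbit p) ≤ C * Real.exp (-r * t) * Metric.infDist (x 0) (orbit p)

end System

/-! ### Triangulated Laman graphs and the independent partition -/

/-- Henneberg sequences for triangulated Laman graphs: start with one edge on two vertices, and
repeatedly join a new vertex `v` to the two ends of an existing edge `{j, k}`. The indices are
the vertex set and the edge set constructed so far. -/
inductive HennebergSeq {V : Type u} : Set V → Set (Sym2 V) → Type u
  | base (a b : V) (hab : a ≠ b) : HennebergSeq {a, b} {s(a, b)}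
  | add {S : Set V} {E : Set (Sym2 V)} (c : HennebergSeq S E) (v j k : V) (hv : v ∉ S)
      (hjk : s(j, k) ∈ E) : HennebergSeq (insert v S) (insert s(j, v) (insert s(k, v) E))

open Classical in
/-- The independent partition of the edge set for a configuration `p`, along a Henneberg
sequence. If `v` is aligned with `j` and `k`, the two new edges join the class of `{j, k}`;
otherwise each of them forms a new class. -/
def HennebergSeq.independentPartition {V : Type u} (p : V → Plane) :
    {S : Set V} → {E : Set (Sym2 V)} → HennebergSeq S E → Set (Set (Sym2 V))
  | _, _, .base a b _ => {{s(a, b)}}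
  | _, _, .add c v j k _ _ =>
      if Collinear ℝ {p j, p k, p v} then
        (fun A => if s(j, k) ∈ A then insert s(j, v) (insert s(k, v) A) else A) ''
          c.independentPartition p
      else
        c.independentPartition p ∪ {{s(j, v)}, {s(k, v)}}

/-- A Henneberg construction of the graph `G`; the graph is a triangulated Laman graph precisely
when there is one. -/
abbrev HennebergConstruction {V : Type u} (G : SimpleGraph V) : Type u :=
  HennebergSeq (univ : Set V) G.edgeSet

section Block

variable {V : Type u}

/-- The set `V_i` of vertices incident to edges in the class `A = E_i`. -/
def blockVerts (A : Set (Sym2 V)) : Set V := {v | ∃ e ∈ A, v ∈ e}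

instance [Fintype V] (A : Set (Sym2 V)) : Fintype (blockVerts A) := Fintype.ofFinite _

/-- The graph `G_i = (V_i, E_i)`. -/
def blockGraph (A : Set (Sym2 V)) : SimpleGraph (blockVerts A) :=
  (SimpleGraph.fromEdgeSet A).induce (blockVerts A)

/-- The interaction laws of the subsystem induced by `G_i`. -/
def blockLaw (f : Sym2 V → ℝ → ℝ) (A : Set (Sym2 V)) : Sym2 (blockVerts A) → ℝ → ℝ :=
  fun e => f (e.map Subtype.val)

/-- The sub-configuration `p_i`. -/
def blockConfig (p : V → Plane) (A : Set (Sym2 V)) : blockVerts A → Plane :=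
  fun v => p v

end Block

end Formation

end

noncomputable section

namespace Formation

universe u

open scoped RealInnerProductSpace

/-! ### Plane geometry and infinitesimal rigid motions -/

/-! The potential is a sum over edges, so it splits as the sum of the potentials of the blocks of
the independent partition. The point is that the blocks can also be moved independently to first
order. Modulo infinitesimal rigid motions, restriction sends velocity fields on `V` to families of
velocity fields on the blocks, and this map is bijective. Injectivity is
`HennebergSeq.isRigidOn_of_forall_blockVerts` and surjectivity is
`HennebergSeq.exists_isRigidOn_sub`. Both go by induction along the construction. A vertex off the
line through `j` and `k` has a velocity determined, and freely prescribable, by the rates of change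
of its two edge lengths. An aligned vertex belongs to a single class, whose motion it follows.

Testing the first derivative against extensions of block velocities shows that every block is
critical. Infinitesimal rigid motions then lie in the radical of each block Hessian, so the Hessian
form of the system, modulo rigid motions, is the orthogonal direct sum of the block Hessian forms.
Radical and positivity can be read off block by block (`radical_iff_blocks`, `positive_iff_blocks`).

It remains to express the two notions through the Hessian form. Nondegeneracy says that the radical
is the three-dimensional space of infinitesimal rigid motions (`isNondegenerate_iff`). Exponential
stability says that the form is positive off that space (`isExponentiallyStable_iff`). For the
latter, positivity makes the squared Euclidean distance to the orbit a Lyapunov function.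
Conversely, along a nonrigid direction with nonpositive Hessian the available energy is too small to
pay for the fast return to the orbit that exponential stability demands. -/

/-- The rotation of the plane by a quarter turn. -/
def rot90 : Plane →L[ℝ] Plane :=
  LinearMap.toContinuousLinearMap
    { toFun := fun x => !₂[-x 1, x 0]
      map_add' := fun x y => by ext i; fin_cases i <;> simp [add_comm]
      map_smul' := fun c x => by ext i; fin_cases i <;> simp }

@[simp]
theorem rot90_apply_zero (x : Plane) : rot90 x 0 = -x 1 := rfl

@[simp]
theorem rot90_apply_one (x : Plane) : rot90 x 1 = x 0 := rfl

theorem plane_inner_eq (x y : Plane) : ⟪x, y⟫ = x 0 * y 0 + x 1 * y 1 := by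
  simp [PiLp.inner_apply, Fin.sum_univ_two, mul_comm]

theorem plane_ext {x y : Plane} (h0 : x 0 = y 0) (h1 : x 1 = y 1) : x = y := by
  ext i; fin_cases i <;> assumption

theorem inner_rot90_self (x : Plane) : ⟪x, rot90 x⟫ = 0 := by
  rw [plane_inner_eq, rot90_apply_zero, rot90_apply_one]; ring

theorem inner_rot90_left (x y : Plane) : ⟪rot90 x, y⟫ = -⟪x, rot90 y⟫ := by
  simp only [plane_inner_eq, rot90_apply_zero, rot90_apply_one]; ring

theorem inner_rot90_rot90 (x y : Plane) : ⟪rot90 x, rot90 y⟫ = ⟪x, y⟫ := by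
  simp only [plane_inner_eq, rot90_apply_zero, rot90_apply_one]; ring

theorem norm_rot90 (x : Plane) : ‖rot90 x‖ = ‖x‖ := by
  rw [← sq_eq_sq₀ (norm_nonneg _) (norm_nonneg _), ← real_inner_self_eq_norm_sq,
    ← real_inner_self_eq_norm_sq, inner_rot90_rot90]

theorem norm_sq_rotation (c s : ℝ) (x : Plane) :
    ‖c • x + s • rot90 x‖ ^ 2 = (c ^ 2 + s ^ 2) * ‖x‖ ^ 2 := by
  simp only [← real_inner_self_eq_norm_sq, plane_inner_eq, PiLp.add_apply, PiLp.smul_apply,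
    rot90_apply_zero, rot90_apply_one, smul_eq_mul]
  ring

/-- Three points spanning a triangle of zero area are collinear. -/
theorem collinear_of_inner_rot90_eq_zero {a b c : Plane}
    (hab : a ≠ b) (h : ⟪rot90 (b - a), c - a⟫ = 0) : Collinear ℝ {a, b, c} := by
  rw [collinear_iff_of_mem (p₀ := a) (by simp)]
  refine ⟨b - a, ?_⟩
  have hn : (b - a) 0 ^ 2 + (b - a) 1 ^ 2 ≠ 0 := by
    intro h0
    apply hab
    have h1 : (b - a) 0 = 0 := by nlinarith [sq_nonneg ((b - a) 0), sq_nonneg ((b - a) 1)]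
    have h2 : (b - a) 1 = 0 := by nlinarith [sq_nonneg ((b - a) 0), sq_nonneg ((b - a) 1)]
    exact (sub_eq_zero.1 (plane_ext (by simpa using h1) (by simpa using h2) : b - a = 0)).symm
  rw [plane_inner_eq, rot90_apply_zero, rot90_apply_one] at h
  have key : ∃ r : ℝ, c = r • (b - a) + a := by
    refine ⟨((c - a) 0 * (b - a) 0 + (c - a) 1 * (b - a) 1) /
      ((b - a) 0 ^ 2 + (b - a) 1 ^ 2), ?_⟩
    rw [← sub_eq_iff_eq_add]
    generalize b - a = d at *
    generalize c - a = e at *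
    apply plane_ext
    · simp only [PiLp.smul_apply, smul_eq_mul]
      field_simp
      linear_combination (-d 1) * h
    · simp only [PiLp.smul_apply, smul_eq_mul]
      field_simp
      linear_combination (d 0) * h
  intro q hq
  simp only [mem_insert_iff, mem_singleton_iff] at hq
  rcases hq with rfl | rfl | rfl
  · exact ⟨0, by simp⟩
  · exact ⟨1, by simp⟩
  · simpa using key

/-- A linear system with two linearly independent normal vectors is solvable. -/
theorem exists_inner_eq_of_area_ne_zero {d e : Plane} (h : ⟪rot90 d, e⟫ ≠ 0) (α β : ℝ) :
    ∃ y : Plane, ⟪d, y⟫ = α ∧ ⟪e, y⟫ = β := by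
  rw [plane_inner_eq, rot90_apply_zero, rot90_apply_one] at h
  refine ⟨(-d 1 * e 0 + d 0 * e 1)⁻¹ • !₂[e 1 * α - d 1 * β, d 0 * β - e 0 * α], ?_, ?_⟩
  · simp only [plane_inner_eq, PiLp.smul_apply, smul_eq_mul, Matrix.cons_val_zero,
      Matrix.cons_val_one]
    linear_combination α * mul_inv_cancel₀ h
  · simp only [plane_inner_eq, PiLp.smul_apply, smul_eq_mul, Matrix.cons_val_zero,
      Matrix.cons_val_one]
    linear_combination β * mul_inv_cancel₀ h

theorem eq_zero_of_area_ne_zero {d e y : Plane} (h : ⟪rot90 d, e⟫ ≠ 0)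
    (h1 : ⟪d, y⟫ = 0) (h2 : ⟪e, y⟫ = 0) : y = 0 := by
  rw [plane_inner_eq] at h1 h2 h
  rw [rot90_apply_zero, rot90_apply_one] at h
  apply plane_ext
  · apply mul_left_cancel₀ h
    simp only [PiLp.zero_apply]
    linear_combination e 1 * h1 - d 1 * h2
  · apply mul_left_cancel₀ h
    simp only [PiLp.zero_apply]
    linear_combination - e 0 * h1 + d 0 * h2

/-- A vector perpendicular to `d ≠ 0` is a multiple of the rotated vector. -/
theorem exists_smul_rot90_of_inner_eq_zero {d y : Plane} (hd : d ≠ 0) (h : ⟪d, y⟫ = 0) :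
    ∃ s : ℝ, y = s • rot90 d := by
  have hn : ⟪d, d⟫ ≠ 0 := inner_self_ne_zero.2 hd
  rw [plane_inner_eq] at h hn
  refine ⟨(d 0 * y 1 - d 1 * y 0) / (d 0 * d 0 + d 1 * d 1), plane_ext ?_ ?_⟩
  · simp only [PiLp.smul_apply, smul_eq_mul, rot90_apply_zero]
    rw [div_mul_eq_mul_div, eq_div_iff hn]
    linear_combination (d 0) * h
  · simp only [PiLp.smul_apply, smul_eq_mul, rot90_apply_one]
    rw [div_mul_eq_mul_div, eq_div_iff hn]
    linear_combination (d 1) * h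

/-! ### Infinitesimal rigid motions. -/

section Rigid

variable {V : Type u}

/-- On the vertex set `S`, the field of velocities `u` is that of an infinitesimal rigid motion
of the configuration `p`. -/
def IsRigidOn (p : V → Plane) (S : Set V) (u : V → Plane) : Prop :=
  ∃ (a : Plane) (s : ℝ), ∀ i ∈ S, u i = a + s • rot90 (p i)

/-- The infinitesimal rigid motion with translational part `a.1` and angular velocity `a.2`. -/
def motion (p : V → Plane) : Plane × ℝ →ₗ[ℝ] (V → Plane) where
  toFun a i := a.1 + a.2 • rot90 (p i)
  map_add' a b := by ext1 i; simp [add_smul]; abel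
  map_smul' c a := by ext1 i; simp [smul_add, mul_smul]

theorem motion_apply (p : V → Plane) (a : Plane × ℝ) (i : V) :
    motion p a i = a.1 + a.2 • rot90 (p i) := rfl

theorem isRigidOn_univ_iff {p u : V → Plane} :
    IsRigidOn p univ u ↔ u ∈ LinearMap.range (motion p) := by
  constructor
  · rintro ⟨a, s, h⟩
    exact ⟨(a, s), funext fun i => (h i (mem_univ i)).symm⟩
  · rintro ⟨a, rfl⟩
    exact ⟨a.1, a.2, fun i _ => rfl⟩

theorem IsRigidOn.mono {p u : V → Plane} {S S' : Set V} (h : IsRigidOn p S u) (hS : S' ⊆ S) :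
    IsRigidOn p S' u := by
  obtain ⟨a, s, h⟩ := h
  exact ⟨a, s, fun i hi => h i (hS hi)⟩

/-- Subtracting the two equations eliminates the translation and leaves a multiple of the rotated
vector `p i - p j`, which is nonzero. -/
theorem rigid_params_unique {p : V → Plane} {i j : V} (hij : p i ≠ p j) {a b : Plane} {s t : ℝ}
    (hi : a + s • rot90 (p i) = b + t • rot90 (p i))
    (hj : a + s • rot90 (p j) = b + t • rot90 (p j)) : a = b ∧ s = t := by
  have h : (s - t) • rot90 (p i - p j) = 0 := by
    rw [map_sub, smul_sub, sub_smul, sub_smul]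
    have h1 : s • rot90 (p i) - t • rot90 (p i) = b - a := by
      rw [sub_eq_sub_iff_add_eq_add, add_comm, hi, add_comm]
    have h2 : s • rot90 (p j) - t • rot90 (p j) = b - a := by
      rw [sub_eq_sub_iff_add_eq_add, add_comm, hj, add_comm]
    rw [← sub_eq_zero.2 (h1.trans h2.symm)]
  have hst : s = t := by
    rcases smul_eq_zero.1 h with h | h
    · linarith
    · rw [← norm_eq_zero, norm_rot90, norm_eq_zero, sub_eq_zero] at h
      exact absurd h hij
  subst hst
  exact ⟨add_right_cancel hi, rfl⟩

theorem motion_injective {p : V → Plane} {i j : V} (hij : p i ≠ p j) :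
    Function.Injective (motion p) := by
  intro a b h
  have := rigid_params_unique hij (congrFun h i) (congrFun h j)
  exact Prod.ext this.1 this.2

theorem finrank_range_motion {p : V → Plane} {i j : V} (hij : p i ≠ p j) :
    Module.finrank ℝ (LinearMap.range (motion p)) = 3 := by
  rw [LinearMap.finrank_range_of_inj (motion_injective hij)]
  simp [Module.finrank_prod]

end Rigid

/-! ### The orbit in terms of cosine and sine. -/

section Orbit

variable {V : Type u}

theorem mem_orbit_iff {p q : V → Plane} :
    q ∈ orbit p ↔ ∃ c s : ℝ, c ^ 2 + s ^ 2 = 1 ∧ ∃ w : Plane,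
      ∀ i, q i = c • p i + s • rot90 (p i) + w := by
  constructor
  · rintro ⟨θ, hθ, w, h⟩
    rw [Matrix.mem_specialOrthogonalGroup_fin_two_iff] at hθ
    obtain ⟨h1, h2, h3⟩ := hθ
    refine ⟨θ 0 0, θ 1 0, by rw [h1, ← h3, h1, h2]; ring, w, fun i => ?_⟩
    rw [h i]
    congr 1
    apply plane_ext
    · simp [Matrix.toLpLin_apply, h2]
    · simp [Matrix.toLpLin_apply, h1]
      ring
  · rintro ⟨c, s, hcs, w, h⟩
    refine ⟨!![c, -s; s, c], ?_, w, fun i => ?_⟩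
    · rw [Matrix.mem_specialOrthogonalGroup_fin_two_iff]
      simp [hcs]
    · rw [h i]
      congr 1
      apply plane_ext
      · simp [Matrix.toLpLin_apply, dotProduct, Fin.sum_univ_two]
      · simp [Matrix.toLpLin_apply, dotProduct, Fin.sum_univ_two]
        ring

theorem self_mem_orbit (p : V → Plane) : p ∈ orbit p :=
  mem_orbit_iff.2 ⟨1, 0, by simp, 0, by simp⟩

end Orbit

/-! ### Calculus of the potential and of the vector field -/

section Laws

variable {φ : ℝ → ℝ}

theorem hasDerivAt_primitive (hφ : ContDiffOn ℝ 1 φ (Ioi 0)) {d : ℝ} (hd : 0 < d) :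
    HasDerivAt (fun x => ∫ t in (1 : ℝ)..x, t * φ t) (d * φ d) d := by
  have hc : ContinuousOn (fun t => t * φ t) (Ioi 0) := continuousOn_id.mul hφ.continuousOn
  have hsub : uIcc 1 d ⊆ Ioi (0 : ℝ) := fun x hx => by
    rcases (mem_uIcc.1 hx) with h | h
    · exact lt_of_lt_of_le one_pos h.1
    · exact lt_of_lt_of_le hd h.1
  exact intervalIntegral.integral_hasDerivAt_right (hc.mono hsub).intervalIntegrable
    (hc.stronglyMeasurableAtFilter isOpen_Ioi d hd) (hc.continuousAt (Ioi_mem_nhds hd))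

theorem hasFDerivAt_norm_plane {z : Plane} (hz : z ≠ 0) :
    HasFDerivAt (fun y : Plane => ‖y‖) (‖z‖⁻¹ • innerSL ℝ z) z := by
  have h := (hasStrictFDerivAt_norm_sq z).hasFDerivAt.sqrt (by simpa using hz)
  simp only [Real.sqrt_sq (norm_nonneg _)] at h
  convert! h using 1
  ext y
  have : ‖z‖ ≠ 0 := norm_ne_zero_iff.2 hz
  simp
  field_simp

theorem hasFDerivAt_pairEnergy (hφ : ContDiffOn ℝ 1 φ (Ioi 0)) {z : Plane} (hz : z ≠ 0) :
    HasFDerivAt (fun y : Plane => ∫ t in (1 : ℝ)..‖y‖, t * φ t) (φ ‖z‖ • innerSL ℝ z) z := by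
  have h := (hasDerivAt_primitive hφ (norm_pos_iff.2 hz)).comp_hasFDerivAt z
    (hasFDerivAt_norm_plane hz)
  convert! h using 1
  have : ‖z‖ ≠ 0 := norm_ne_zero_iff.2 hz
  rw [smul_smul]
  congr 1
  field_simp

/-- The derivative at `z` of the force `y ↦ φ(‖y‖) y`. -/
def forceDeriv (φ : ℝ → ℝ) (z : Plane) : Plane →L[ℝ] Plane :=
  φ ‖z‖ • ContinuousLinearMap.id ℝ Plane +
    (deriv φ ‖z‖ / ‖z‖) • (innerSL ℝ z).smulRight z

theorem forceDeriv_apply (φ : ℝ → ℝ) (z y : Plane) :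
    forceDeriv φ z y = φ ‖z‖ • y + (deriv φ ‖z‖ / ‖z‖ * ⟪z, y⟫) • z := by
  simp [forceDeriv, smul_smul]

theorem inner_forceDeriv_comm (φ : ℝ → ℝ) (z x y : Plane) :
    ⟪forceDeriv φ z x, y⟫ = ⟪forceDeriv φ z y, x⟫ := by
  simp only [forceDeriv_apply, inner_add_left, inner_smul_left, real_inner_comm x y]
  simp
  ring

/-- Infinitesimal form of the rotation equivariance of a central force: the radial term of
`forceDeriv` does not see a tangential vector. -/
theorem forceDeriv_rot90_self (φ : ℝ → ℝ) (z : Plane) :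
    forceDeriv φ z (rot90 z) = rot90 (φ ‖z‖ • z) := by
  simp [forceDeriv_apply, inner_rot90_self]

theorem forceDeriv_neg (φ : ℝ → ℝ) (z : Plane) : forceDeriv φ (-z) = forceDeriv φ z := by
  ext1 y
  simp [forceDeriv_apply]

theorem hasFDerivAt_force (hφ : ContDiffOn ℝ 1 φ (Ioi 0)) {z : Plane} (hz : z ≠ 0) :
    HasFDerivAt (fun y : Plane => φ ‖y‖ • y) (forceDeriv φ z) z := by
  have hz' : 0 < ‖z‖ := norm_pos_iff.2 hz
  have h1 : HasDerivAt φ (deriv φ ‖z‖) ‖z‖ :=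
    ((hφ.contDiffAt (Ioi_mem_nhds hz')).differentiableAt one_ne_zero).hasDerivAt
  have h := (h1.comp_hasFDerivAt z (hasFDerivAt_norm_plane hz)).smul (hasFDerivAt_id z)
  convert! h using 1
  ext1 y
  simp [forceDeriv_apply, smul_smul, div_eq_mul_inv, mul_assoc]

theorem contDiffAt_force (hφ : ContDiffOn ℝ 1 φ (Ioi 0)) {z : Plane} (hz : z ≠ 0) :
    ContDiffAt ℝ 1 (fun y : Plane => φ ‖y‖ • y) z := by
  have hz' : 0 < ‖z‖ := norm_pos_iff.2 hz
  exact ((hφ.contDiffAt (Ioi_mem_nhds hz')).comp z (contDiffAt_norm ℝ hz)).smul contDiffAt_id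

end Laws

/-! ### Sums over edges as symmetrized sums over ordered pairs. -/

section PairSum

variable {V : Type u} [Fintype V]

open Classical in
/-- The sum of `k i j` over the edges of `G`, as half of the sum over ordered pairs. -/
def pairSum (G : SimpleGraph V) (k : V → V → ℝ) : ℝ :=
  2⁻¹ * ∑ i, ∑ j, if G.Adj i j then k i j else 0

theorem pairSum_congr {G : SimpleGraph V} {k l : V → V → ℝ}
    (h : ∀ i j, G.Adj i j → k i j = l i j) : pairSum G k = pairSum G l := by
  classical
  unfold pairSum
  congr 1
  refine Finset.sum_congr rfl fun i _ => Finset.sum_congr rfl fun j _ => ?_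
  split_ifs with hij
  · exact h i j hij
  · rfl

theorem pairSum_neg (G : SimpleGraph V) (k : V → V → ℝ) :
    pairSum G (fun i j => -k i j) = -pairSum G k := by
  classical
  unfold pairSum
  rw [← mul_neg, ← Finset.sum_neg_distrib]
  congr 1
  refine Finset.sum_congr rfl fun i _ => ?_
  rw [← Finset.sum_neg_distrib]
  refine Finset.sum_congr rfl fun j _ => ?_
  split_ifs <;> simp

-- Each edge comes from exactly two ordered pairs, since a simple graph has no loops; this is the
-- factor one half in `pairSum`.
open Classical in
theorem sum_edges_eq_pairSum (G : SimpleGraph V) (h : Sym2 V → ℝ) :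
    ∑ e : Sym2 V with e ∈ G.edgeSet, h e = pairSum G fun i j => h s(i, j) := by
  unfold pairSum
  rw [← Fintype.sum_prod_type' (f := fun i j => if G.Adj i j then h s(i, j) else 0),
    ← Finset.sum_filter,
    ← Finset.sum_fiberwise_of_maps_to (s := {x : V × V | G.Adj x.1 x.2})
      (t := {e : Sym2 V | e ∈ G.edgeSet}) (g := fun x => s(x.1, x.2))
      (by simp), Finset.mul_sum]
  refine Finset.sum_congr rfl fun e he => ?_
  induction e with | _ a b =>
  have hab : G.Adj a b := by simpa using he
  have hfib : ({x ∈ ({x : V × V | G.Adj x.1 x.2} : Finset (V × V)) | s(x.1, x.2) = s(a, b)} :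
      Finset (V × V)) = {(a, b), (b, a)} := by
    ext ⟨x, y⟩
    simp only [Finset.mem_filter, Finset.mem_univ, true_and, Finset.mem_insert,
      Finset.mem_singleton, Prod.mk.injEq, Sym2.eq_iff]
    constructor
    · exact fun h => h.2
    · rintro (⟨rfl, rfl⟩ | ⟨rfl, rfl⟩)
      · exact ⟨hab, .inl ⟨rfl, rfl⟩⟩
      · exact ⟨hab.symm, .inr ⟨rfl, rfl⟩⟩
  rw [hfib, Finset.sum_pair (by simp [hab.ne]), Sym2.eq_swap (a := b)]
  ring

-- Discrete summation by parts: the antisymmetry of `a` (action equals reaction) turns forces at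
-- vertices into work along edges.
open Classical in
theorem sum_inner_eq_pairSum (G : SimpleGraph V) (a : V → V → Plane)
    (ha : ∀ i j, G.Adj i j → a j i = -a i j) (u : V → Plane) :
    ∑ i, ⟪∑ j with G.Adj i j, a i j, u i⟫ = pairSum G fun i j => ⟪a i j, u i - u j⟫ := by
  have h1 : ∑ i, ⟪∑ j with G.Adj i j, a i j, u i⟫
      = ∑ i, ∑ j, if G.Adj i j then ⟪a i j, u i⟫ else 0 := by
    refine Finset.sum_congr rfl fun i _ => ?_
    rw [sum_inner, Finset.sum_filter]
  have h2 : ∑ i, ∑ j, (if G.Adj i j then ⟪a i j, u i⟫ else 0)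
      = -∑ i, ∑ j, if G.Adj i j then ⟪a i j, u j⟫ else 0 := by
    rw [Finset.sum_comm, ← Finset.sum_neg_distrib]
    refine Finset.sum_congr rfl fun i _ => ?_
    rw [← Finset.sum_neg_distrib]
    refine Finset.sum_congr rfl fun j _ => ?_
    rw [G.adj_comm j i]
    split_ifs with h
    · rw [ha i j h, inner_neg_left]
    · simp
  have h3 : pairSum G (fun i j => ⟪a i j, u i - u j⟫) =
      2⁻¹ * (∑ i, ∑ j, (if G.Adj i j then ⟪a i j, u i⟫ else 0)
        - ∑ i, ∑ j, if G.Adj i j then ⟪a i j, u j⟫ else 0) := by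
    unfold pairSum
    congr 1
    rw [← Finset.sum_sub_distrib]
    refine Finset.sum_congr rfl fun i _ => ?_
    rw [← Finset.sum_sub_distrib]
    refine Finset.sum_congr rfl fun j _ => ?_
    split_ifs with h
    · exact inner_sub_right _ _ _
    · simp
  rw [h1, h3]
  linarith

end PairSum

/-! ### First and second derivatives of the potential. -/

section System

variable {V : Type u}

/-- The difference of the positions of `i` and `j` as a linear function of the configuration. -/
def relPos (i j : V) : (V → Plane) →L[ℝ] Plane :=
  ContinuousLinearMap.proj (R := ℝ) (φ := fun _ : V => Plane) i - ContinuousLinearMap.proj j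

@[simp]
theorem relPos_apply (i j : V) (u : V → Plane) : relPos i j u = u i - u j := rfl

variable [Fintype V] {G : SimpleGraph V} {f : Sym2 V → ℝ → ℝ}

/-- The scalar product of `(ℝ²)^V`. -/
def innerProd (u w : V → Plane) : ℝ := ∑ i, ⟪u i, w i⟫

/-- The Hessian of the potential function as a bilinear form. -/
def hessForm (G : SimpleGraph V) (f : Sym2 V → ℝ → ℝ) (p u w : V → Plane) : ℝ :=
  pairSum G fun i j => ⟪forceDeriv (f s(i, j)) (p i - p j) (u i - u j), w i - w j⟫

/-- The derivative of the potential function at `p` in the direction `u`. -/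
def virtualWork (G : SimpleGraph V) (f : Sym2 V → ℝ → ℝ) (p u : V → Plane) : ℝ :=
  pairSum G fun i j => f s(i, j) ‖p i - p j‖ * ⟪p i - p j, u i - u j⟫

theorem potential_eq_pairSum (G : SimpleGraph V) (f : Sym2 V → ℝ → ℝ) (p : V → Plane) :
    potential G f p = pairSum G fun i j => ∫ t in (1 : ℝ)..‖p i - p j‖, t * f s(i, j) t := by
  unfold potential
  rw [sum_edges_eq_pairSum]
  simp [edgeLength, dist_eq_norm]

theorem isOpen_configSpace (G : SimpleGraph V) : IsOpen (configSpace G) := by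
  have : configSpace G = ⋂ i, ⋂ j, ⋂ (_ : G.Adj i j), {p | p i ≠ p j} := by
    ext p; simp [configSpace]
  rw [this]
  exact isOpen_iInter_of_finite fun i => isOpen_iInter_of_finite fun j =>
    isOpen_iInter_of_finite fun _ =>
      isOpen_ne_fun (continuous_apply i) (continuous_apply j)

/-- The dynamics is the negative gradient flow of the potential. -/
theorem innerProd_vectorField (G : SimpleGraph V) (f : Sym2 V → ℝ → ℝ) (p u : V → Plane) :
    innerProd (vectorField G f p) u = -virtualWork G f p u := by
  unfold innerProd vectorField
  rw [sum_inner_eq_pairSum]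
  · unfold virtualWork
    rw [← pairSum_neg]
    refine pairSum_congr fun i j _ => ?_
    rw [dist_eq_norm, inner_smul_left, ← neg_sub (p i) (p j), inner_neg_left]
    simp
  · intro i j _
    rw [dist_comm, Sym2.eq_swap, ← smul_neg, neg_sub]

open Classical in
/-- The derivative of the potential function as a continuous linear map. -/
def workCLM (G : SimpleGraph V) (f : Sym2 V → ℝ → ℝ) (q : V → Plane) : (V → Plane) →L[ℝ] ℝ :=
  (2⁻¹ : ℝ) • ∑ i, ∑ j, if G.Adj i j then
    (f s(i, j) ‖q i - q j‖ • innerSL ℝ (q i - q j)).comp (relPos i j) else 0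

theorem workCLM_apply (G : SimpleGraph V) (f : Sym2 V → ℝ → ℝ) (q u : V → Plane) :
    workCLM G f q u = virtualWork G f q u := by
  simp only [workCLM, virtualWork, pairSum, smul_apply,
    sum_apply, smul_eq_mul]
  congr 1
  refine Finset.sum_congr rfl fun i _ => Finset.sum_congr rfl fun j _ => ?_
  split_ifs
  · rw [ContinuousLinearMap.comp_apply, smul_apply, innerSL_apply_apply, relPos_apply,
      smul_eq_mul]
  · rfl

theorem hasFDerivAt_potential (hf : ∀ e ∈ G.edgeSet, ContDiffOn ℝ 1 (f e) (Ioi 0))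
    {q : V → Plane} (hq : q ∈ configSpace G) :
    HasFDerivAt (potential G f) (workCLM G f q) q := by
  classical
  rw [funext (potential_eq_pairSum G f)]
  unfold pairSum workCLM
  refine HasFDerivAt.const_mul (HasFDerivAt.fun_sum fun i _ => HasFDerivAt.fun_sum fun j _ => ?_) _
  split_ifs with h
  · exact HasFDerivAt.comp (g := fun y : Plane => ∫ t in (1 : ℝ)..‖y‖, t * f s(i, j) t) q
      (hasFDerivAt_pairEnergy (hf s(i, j) h) (sub_ne_zero.2 (hq i j h))) (relPos i j).hasFDerivAt
  · exact hasFDerivAt_const _ _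

theorem isCriticalOrbit_iff (hf : ∀ e ∈ G.edgeSet, ContDiffOn ℝ 1 (f e) (Ioi 0))
    {p : V → Plane} :
    IsCriticalOrbit G f p ↔ p ∈ configSpace G ∧ ∀ u, virtualWork G f p u = 0 := by
  refine and_congr_right fun hp => ?_
  rw [(hasFDerivAt_potential hf hp).fderiv, ContinuousLinearMap.ext_iff]
  simp [workCLM_apply]

open Classical in
/-- The linearization of the vector field at `p`. -/
def fieldDeriv (G : SimpleGraph V) (f : Sym2 V → ℝ → ℝ) (p : V → Plane) :
    (V → Plane) →L[ℝ] (V → Plane) :=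
  ContinuousLinearMap.pi fun i => ∑ j with G.Adj i j,
    (forceDeriv (f s(i, j)) (p j - p i)).comp (relPos j i)

theorem hasFDerivAt_vectorField (hf : ∀ e ∈ G.edgeSet, ContDiffOn ℝ 1 (f e) (Ioi 0))
    {p : V → Plane} (hp : p ∈ configSpace G) :
    HasFDerivAt (vectorField G f) (fieldDeriv G f p) p := by
  classical
  rw [hasFDerivAt_pi']
  intro i
  unfold vectorField fieldDeriv
  rw [ContinuousLinearMap.proj_pi]
  refine HasFDerivAt.fun_sum fun j hj => ?_
  have hij : G.Adj i j := by simpa using hj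
  simp only [dist_eq_norm']
  exact HasFDerivAt.comp (g := fun y : Plane => f s(i, j) ‖y‖ • y) p
    (hasFDerivAt_force (hf s(i, j) hij) (sub_ne_zero.2 (hp j i hij.symm)))
    (relPos j i).hasFDerivAt

theorem contDiffAt_vectorField (hf : ∀ e ∈ G.edgeSet, ContDiffOn ℝ 1 (f e) (Ioi 0))
    {p : V → Plane} (hp : p ∈ configSpace G) : ContDiffAt ℝ 1 (vectorField G f) p := by
  classical
  rw [contDiffAt_pi]
  intro i
  unfold vectorField
  refine ContDiffAt.sum fun j hj => ?_
  have hij : G.Adj i j := by simpa using hj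
  simp only [dist_eq_norm']
  exact ContDiffAt.comp (g := fun y : Plane => f s(i, j) ‖y‖ • y) p (contDiffAt_force (hf s(i, j) hij) (sub_ne_zero.2 (hp j i hij.symm)))
      (relPos j i).contDiff.contDiffAt

/-- Since the field is the negative gradient, its linearization represents the negative of the
Hessian form; linearity and continuity of the form are inherited from here. -/
theorem innerProd_fieldDeriv (G : SimpleGraph V) (f : Sym2 V → ℝ → ℝ) (p u w : V → Plane) :
    innerProd (fieldDeriv G f p u) w = -hessForm G f p u w := by
  classical
  have : ∀ i, fieldDeriv G f p u i = ∑ j with G.Adj i j,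
      -forceDeriv (f s(i, j)) (p i - p j) (u i - u j) := by
    intro i
    simp only [fieldDeriv, ContinuousLinearMap.pi_apply, sum_apply]
    refine Finset.sum_congr rfl fun j _ => ?_
    rw [← forceDeriv_neg, neg_sub, ← map_neg, neg_sub]
    rw [ContinuousLinearMap.comp_apply, relPos_apply]
  unfold innerProd
  simp only [this]
  rw [sum_inner_eq_pairSum]
  · unfold hessForm
    rw [← pairSum_neg]
    exact pairSum_congr fun i j _ => inner_neg_left _ _
  · intro i j _
    rw [Sym2.eq_swap, ← forceDeriv_neg, neg_sub, ← map_neg, neg_sub]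
    simp

theorem hessForm_comm (G : SimpleGraph V) (f : Sym2 V → ℝ → ℝ) (p u w : V → Plane) :
    hessForm G f p u w = hessForm G f p w u :=
  pairSum_congr fun _ _ _ => inner_forceDeriv_comm _ _ _ _

theorem hessForm_add_left (G : SimpleGraph V) (f : Sym2 V → ℝ → ℝ) (p u u' w : V → Plane) :
    hessForm G f p (u + u') w = hessForm G f p u w + hessForm G f p u' w := by
  have h := innerProd_fieldDeriv G f p (u + u') w
  have h1 := innerProd_fieldDeriv G f p u w
  have h2 := innerProd_fieldDeriv G f p u' w
  have : innerProd (fieldDeriv G f p (u + u')) w =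
      innerProd (fieldDeriv G f p u) w + innerProd (fieldDeriv G f p u') w := by
    simp [innerProd, inner_add_left, Finset.sum_add_distrib]
  linarith

theorem hessForm_smul_left (G : SimpleGraph V) (f : Sym2 V → ℝ → ℝ) (p u w : V → Plane) (c : ℝ) :
    hessForm G f p (c • u) w = c * hessForm G f p u w := by
  have h := innerProd_fieldDeriv G f p (c • u) w
  have h1 := innerProd_fieldDeriv G f p u w
  have : innerProd (fieldDeriv G f p (c • u)) w = c * innerProd (fieldDeriv G f p u) w := by
    simp [innerProd, inner_smul_left, Finset.mul_sum]
  rw [h, h1] at this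
  linarith

theorem hessForm_smul_right (G : SimpleGraph V) (f : Sym2 V → ℝ → ℝ) (p u w : V → Plane)
    (c : ℝ) : hessForm G f p u (c • w) = c * hessForm G f p u w := by
  rw [hessForm_comm, hessForm_smul_left, hessForm_comm]

/-- Differentiated rotation invariance: pairing a rotation with `w` gives the virtual work of a
rotated multiple of `w`, which vanishes by criticality. Translations contribute nothing. -/
theorem hessForm_motion {p : V → Plane} (h : ∀ u, virtualWork G f p u = 0) (a : Plane × ℝ)
    (w : V → Plane) : hessForm G f p (motion p a) w = 0 := by
  have h1 : hessForm G f p (motion p a) w = virtualWork G f p fun i => -a.2 • rot90 (w i) := by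
    refine pairSum_congr fun i j _ => ?_
    rw [motion_apply, motion_apply, add_sub_add_left_eq_sub, ← smul_sub, ← map_sub, map_smul,
      forceDeriv_rot90_self, inner_smul_left, inner_rot90_left, inner_smul_left, ← smul_sub,
      ← map_sub, inner_smul_right]
    simp
    ring
  rw [h1, h]

end System

/-! ### Nondegeneracy in terms of the Hessian form -/

/-- A symmetric matrix is diagonalizable, so algebraic and geometric multiplicity of the eigenvalue
zero agree. -/
theorem zeroEigenvalueCount_eq_finrank_ker {n : Type u} [Fintype n] {H : Matrix n n ℝ}
    (hH : H.IsHermitian) :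
    zeroEigenvalueCount H = Module.finrank ℝ (LinearMap.ker H.mulVecLin) := by
  classical
  have h1 : zeroEigenvalueCount H = Fintype.card {i // hH.eigenvalues i = 0} := by
    unfold zeroEigenvalueCount
    rw [show H.charpoly = _ from by convert! rfl, hH.roots_charpoly_eq_eigenvalues,
      Multiset.count_map, Fintype.card_subtype]
    simp [Finset.card_def, eq_comm]
  have h2 := hH.rank_eq_card_non_zero_eigs
  have h3 := LinearMap.finrank_range_add_finrank_ker H.mulVecLin
  have h4 := Fintype.card_subtype_compl (fun i => hH.eigenvalues i = 0)
  have h5 := Fintype.card_subtype_le (fun i => hH.eigenvalues i = 0)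
  rw [Module.finrank_fintype_fun_eq_card] at h3
  unfold Matrix.rank at h2
  change Fintype.card {i // hH.eigenvalues i ≠ 0} = _ at h4
  omega

/-- The coordinates on `(ℝ²)^V`. -/
def coordEquiv (V : Type u) : (V × Fin 2 → ℝ) ≃ₗ[ℝ] (V → Plane) where
  toFun x i := WithLp.toLp 2 fun k => x (i, k)
  invFun u a := u a.1 a.2
  map_add' _ _ := rfl
  map_smul' _ _ := rfl
  left_inv _ := rfl
  right_inv _ := rfl

theorem coordEquiv_apply {V : Type u} (x : V × Fin 2 → ℝ) (i : V) (k : Fin 2) :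
    coordEquiv V x i k = x (i, k) := rfl

section System

variable {V : Type u} [Fintype V] {G : SimpleGraph V} {f : Sym2 V → ℝ → ℝ}

/-- The Hessian form as a bundled bilinear form. -/
def hessBilin (G : SimpleGraph V) (f : Sym2 V → ℝ → ℝ) (p : V → Plane) :
    LinearMap.BilinForm ℝ (V → Plane) :=
  LinearMap.mk₂ ℝ (hessForm G f p) (hessForm_add_left G f p)
    (fun c u w => hessForm_smul_left G f p u w c)
    (fun u w w' => by
      rw [hessForm_comm, hessForm_add_left, hessForm_comm G f p w, hessForm_comm G f p w'])
    (fun c u w => hessForm_smul_right G f p u w c)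

theorem hessBilin_apply (p u w : V → Plane) : hessBilin G f p u w = hessForm G f p u w := rfl

theorem hessian_apply (hf : ∀ e ∈ G.edgeSet, ContDiffOn ℝ 1 (f e) (Ioi 0))
    {p : V → Plane} (hp : p ∈ configSpace G) (a b : V × Fin 2) :
    hessian G f p a b = hessForm G f p (coordVec a) (coordVec b) := by
  -- The gradient formula needs distinct adjacent positions, so it is used only on a neighbourhood
  -- of `p`, which suffices for the second derivative.
  have h1 : (fun q => fderiv ℝ (potential G f) q (coordVec b)) =ᶠ[𝓝 p]
      fun q => -innerProd (vectorField G f q) (coordVec b) := by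
    filter_upwards [(isOpen_configSpace G).mem_nhds hp] with q hq
    rw [(hasFDerivAt_potential hf hq).fderiv, workCLM_apply, innerProd_vectorField, neg_neg]
  have h2 : HasFDerivAt (fun q => -innerProd (vectorField G f q) (coordVec b))
      (-∑ i, (innerSL ℝ (coordVec b i)).comp
        ((ContinuousLinearMap.proj (R := ℝ) (φ := fun _ : V => Plane) i).comp
          (fieldDeriv G f p))) p := by
    have hv := hasFDerivAt_pi'.1 (hasFDerivAt_vectorField hf hp)
    refine HasFDerivAt.neg ?_
    unfold innerProd
    simp only [real_inner_comm (coordVec b _)]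
    exact HasFDerivAt.fun_sum fun i _ => ((innerSL ℝ (coordVec b i)).hasFDerivAt).comp p (hv i)
  have h3 : hessForm G f p (coordVec a) (coordVec b) =
      -innerProd (fieldDeriv G f p (coordVec a)) (coordVec b) := by
    rw [innerProd_fieldDeriv, neg_neg]
  unfold hessian
  rw [Matrix.of_apply, h1.fderiv_eq, h2.fderiv, h3]
  simp [innerProd, real_inner_comm]

theorem coordEquiv_eq_sum (x : V × Fin 2 → ℝ) :
    coordEquiv V x = ∑ a, x a • coordVec a := by
  classical
  ext i k
  simp only [Finset.sum_apply, WithLp.ofLp_sum, Pi.smul_apply, PiLp.smul_apply]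
  rw [Finset.sum_eq_single (i, k)]
  · simp [coordVec, coordEquiv_apply]
  · rintro ⟨j, l⟩ _ hne
    by_cases hj : j = i
    · subst hj
      have : k ≠ l := fun h => hne (by rw [h])
      simp [coordVec, this]
    · simp [coordVec, Ne.symm hj]
  · simp

theorem hessian_mulVec_eq_zero_iff (hf : ∀ e ∈ G.edgeSet, ContDiffOn ℝ 1 (f e) (Ioi 0))
    {p : V → Plane} (hp : p ∈ configSpace G) (x : V × Fin 2 → ℝ) :
    (hessian G f p).mulVec x = 0 ↔ ∀ w, hessForm G f p (coordEquiv V x) w = 0 := by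
  have h : ∀ a, (hessian G f p).mulVec x a = hessBilin G f p (coordEquiv V x) (coordVec a) := by
    intro a
    rw [coordEquiv_eq_sum, map_sum, LinearMap.sum_apply, Matrix.mulVec, dotProduct]
    refine Finset.sum_congr rfl fun b _ => ?_
    rw [map_smul, LinearMap.smul_apply, hessBilin_apply, hessian_apply hf hp, hessForm_comm,
      smul_eq_mul, mul_comm]
  constructor
  · intro h0 w
    obtain ⟨y, rfl⟩ := (coordEquiv V).surjective w
    rw [coordEquiv_eq_sum y, ← hessBilin_apply, map_sum]
    refine Finset.sum_eq_zero fun a _ => ?_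
    rw [map_smul, ← h, h0]
    simp
  · intro h0
    ext a
    rw [h, hessBilin_apply, h0]
    rfl

/-- A critical orbit is nondegenerate if and only if the radical of the Hessian form consists
of the infinitesimal rigid motions. -/
theorem isNondegenerate_iff (hf : ∀ e ∈ G.edgeSet, ContDiffOn ℝ 1 (f e) (Ioi 0))
    {p : V → Plane} (hp : IsCriticalOrbit G f p) {i j : V} (hij : p i ≠ p j) :
    IsNondegenerate G f p ↔ ∀ u, (∀ w, hessForm G f p u w = 0) → IsRigidOn p univ u := by
  rw [isCriticalOrbit_iff hf] at hp
  have hH : (hessian G f p).IsHermitian := by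
    ext a b
    rw [Matrix.conjTranspose_apply, hessian_apply hf hp.1, hessian_apply hf hp.1, hessForm_comm]
    simp
  have hker : (LinearMap.ker (hessian G f p).mulVecLin).map (coordEquiv V).toLinearMap =
      LinearMap.ker (hessBilin G f p) := by
    ext u
    simp only [Submodule.mem_map, LinearMap.mem_ker, Matrix.mulVecLin_apply,
      LinearEquiv.coe_coe]
    constructor
    · rintro ⟨x, hx, rfl⟩
      rw [hessian_mulVec_eq_zero_iff hf hp.1] at hx
      exact LinearMap.ext hx
    · intro hu
      refine ⟨(coordEquiv V).symm u, ?_, by simp⟩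
      rw [hessian_mulVec_eq_zero_iff hf hp.1]
      intro w
      rw [LinearEquiv.apply_symm_apply, ← hessBilin_apply, hu]
      rfl
  -- The motions always lie in the radical and form a three-dimensional space, so a radical of
  -- dimension three can only be this space.
  have hle : LinearMap.range (motion p) ≤ LinearMap.ker (hessBilin G f p) := by
    rintro _ ⟨a, rfl⟩
    exact LinearMap.ext (hessForm_motion hp.2 a)
  unfold IsNondegenerate
  rw [zeroEigenvalueCount_eq_finrank_ker hH,
    ← LinearEquiv.finrank_map_eq (coordEquiv V) (LinearMap.ker (hessian G f p).mulVecLin)]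
  change Module.finrank ℝ ((LinearMap.ker (hessian G f p).mulVecLin).map
    (coordEquiv V).toLinearMap) = 3 ↔ _
  rw [hker]
  constructor
  · intro h3 u hu
    rw [isRigidOn_univ_iff, Submodule.eq_of_le_of_finrank_eq hle
      ((finrank_range_motion hij).trans h3.symm)]
    exact LinearMap.ext hu
  · intro h
    have : LinearMap.range (motion p) = LinearMap.ker (hessBilin G f p) := by
      refine le_antisymm hle fun u hu => ?_
      rw [← isRigidOn_univ_iff]
      exact h u fun w => by rw [← hessBilin_apply, LinearMap.mem_ker.1 hu]; rfl
    rw [← this, finrank_range_motion hij]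

end System

/-! ### The action of the group of rigid motions -/

section Action

variable {V : Type u}

/-- The action on configurations of the rigid motion `z ↦ c z + s J z + w`. -/
def rigidAct (c s : ℝ) (w : Plane) (x : V → Plane) : V → Plane :=
  fun i => c • x i + s • rot90 (x i) + w

theorem rigidAct_sub (c s : ℝ) (w : Plane) (x y : V → Plane) (i j : V) :
    rigidAct c s w x i - rigidAct c s w y j = c • (x i - y j) + s • rot90 (x i - y j) := by
  simp only [rigidAct, map_sub, smul_sub]
  abel

theorem rigidAct_sub_rigidAct (c s : ℝ) (w : Plane) (x y : V → Plane) :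
    rigidAct c s w x - rigidAct c s w y = rigidAct c s 0 (x - y) := by
  ext1 i
  rw [Pi.sub_apply, rigidAct_sub]
  simp [rigidAct]

theorem norm_rotation {c s : ℝ} (h : c ^ 2 + s ^ 2 = 1) (z : Plane) :
    ‖c • z + s • rot90 z‖ = ‖z‖ := by
  rw [← sq_eq_sq₀ (norm_nonneg _) (norm_nonneg _), norm_sq_rotation, h, one_mul]

theorem norm_rigidAct_sub {c s : ℝ} (h : c ^ 2 + s ^ 2 = 1) (w : Plane) (x y : V → Plane)
    (i j : V) : ‖rigidAct c s w x i - rigidAct c s w y j‖ = ‖x i - y j‖ := by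
  rw [rigidAct_sub, norm_rotation h]

theorem dist_rigidAct [Fintype V] {c s : ℝ} (h : c ^ 2 + s ^ 2 = 1) (w : Plane)
    (x y : V → Plane) : dist (rigidAct c s w x) (rigidAct c s w y) = dist x y := by
  simp only [dist_pi_def, nndist_eq_nnnorm]
  congr 2
  ext i
  exact norm_rigidAct_sub h w x y i i

theorem rigidAct_rigidAct_inv {c s : ℝ} (h : c ^ 2 + s ^ 2 = 1) (w : Plane) (x : V → Plane) :
    rigidAct c s w (rigidAct c (-s) (-(c • w - s • rot90 w)) x) = x := by
  ext1 i
  apply plane_ext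
  · simp [rigidAct]
    linear_combination (x i 0 - w 0) * h
  · simp [rigidAct]
    linear_combination (x i 1 - w 1) * h

theorem exists_rigidAct_eq {c s : ℝ} (h : c ^ 2 + s ^ 2 = 1) (w : Plane) (x : V → Plane) :
    ∃ y, rigidAct c s w y = x :=
  ⟨_, rigidAct_rigidAct_inv h w x⟩

theorem mem_orbit_iff_rigidAct {p q : V → Plane} :
    q ∈ orbit p ↔ ∃ c s : ℝ, c ^ 2 + s ^ 2 = 1 ∧ ∃ w, rigidAct c s w p = q := by
  rw [mem_orbit_iff]
  simp only [rigidAct, funext_iff, eq_comm]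

theorem rigidAct_mem_orbit {c s : ℝ} (h : c ^ 2 + s ^ 2 = 1) (w : Plane) {p q : V → Plane}
    (hq : q ∈ orbit p) : rigidAct c s w q ∈ orbit p := by
  obtain ⟨c', s', h', w', rfl⟩ := mem_orbit_iff_rigidAct.1 hq
  refine mem_orbit_iff_rigidAct.2 ⟨c * c' - s * s', s * c' + c * s', ?_,
    c • w' + s • rot90 w' + w, ?_⟩
  · linear_combination (c ^ 2 + s ^ 2) * h' + h
  · ext1 i
    apply plane_ext <;> · simp [rigidAct]; ring

/-- Positions relative to a base vertex forget the translation. In these coordinates the orbit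
becomes the continuous image of the unit circle, hence compact, and the orbit is the preimage of
that image. -/
theorem isClosed_orbit [Fintype V] (p : V → Plane) : IsClosed (orbit p) := by
  rcases isEmpty_or_nonempty V with hV | ⟨⟨i₀⟩⟩
  · exact Set.Subsingleton.isClosed Set.subsingleton_of_subsingleton
  · have hK : IsCompact {a : ℝ × ℝ | a.1 ^ 2 + a.2 ^ 2 = 1} := by
      refine Metric.isCompact_of_isClosed_isBounded
        (isClosed_eq (by fun_prop) continuous_const) ?_
      refine (Metric.isBounded_closedBall (x := (0 : ℝ × ℝ)) (r := 1)).subset fun a ha => ?_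
      have ha' : a.1 ^ 2 + a.2 ^ 2 = 1 := ha
      rw [mem_closedBall_zero_iff, Prod.norm_def, max_le_iff, Real.norm_eq_abs, Real.norm_eq_abs,
        abs_le_one_iff_mul_self_le_one, abs_le_one_iff_mul_self_le_one]
      constructor <;> nlinarith [sq_nonneg a.1, sq_nonneg a.2]
    have hc : Continuous fun (a : ℝ × ℝ) (i : V) =>
        a.1 • (p i - p i₀) + a.2 • rot90 (p i - p i₀) := by fun_prop
    have hcl := (hK.image hc).isClosed
    have hg : Continuous fun (q : V → Plane) (i : V) => q i - q i₀ := by fun_prop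
    convert hcl.preimage hg using 1
    ext q
    rw [mem_orbit_iff_rigidAct, mem_preimage]
    constructor
    · rintro ⟨c, s, h, w, rfl⟩
      exact ⟨(c, s), h, funext fun i => (rigidAct_sub c s w p p i i₀).symm⟩
    · rintro ⟨a, h, ha⟩
      refine ⟨a.1, a.2, h, q i₀ - (a.1 • p i₀ + a.2 • rot90 (p i₀)), funext fun i => ?_⟩
      have hi := congrFun ha i
      simp only [map_sub, smul_sub] at hi
      simp only [rigidAct]
      rw [← sub_eq_zero]
      rw [← sub_eq_zero] at hi
      rw [← hi]
      abel

variable [Fintype V] {G : SimpleGraph V} {f : Sym2 V → ℝ → ℝ}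

theorem potential_rigidAct {c s : ℝ} (h : c ^ 2 + s ^ 2 = 1) (w : Plane) (x : V → Plane) :
    potential G f (rigidAct c s w x) = potential G f x := by
  simp only [potential_eq_pairSum, norm_rigidAct_sub h]

theorem vectorField_rigidAct {c s : ℝ} (h : c ^ 2 + s ^ 2 = 1) (w : Plane) (x : V → Plane) :
    vectorField G f (rigidAct c s w x) = rigidAct c s 0 (vectorField G f x) := by
  ext1 i
  simp only [vectorField, rigidAct, map_sum, Finset.smul_sum, ← Finset.sum_add_distrib, add_zero]
  refine Finset.sum_congr rfl fun j _ => ?_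
  have h1 := rigidAct_sub c s w x x j i
  have h2 : dist (rigidAct c s w x i) (rigidAct c s w x j) = dist (x i) (x j) := by
    rw [dist_eq_norm, norm_rigidAct_sub h, dist_eq_norm]
  simp only [rigidAct] at h1 h2
  rw [h1, h2, smul_add, map_smul, smul_comm c, smul_comm s]

end Action

/-! ### The scalar product and local estimates -/

section Estimates

variable {V : Type u} [Fintype V]

theorem innerProd_self_nonneg (u : V → Plane) : 0 ≤ innerProd u u :=
  Finset.sum_nonneg fun _ _ => real_inner_self_nonneg

theorem innerProd_comm (u w : V → Plane) : innerProd u w = innerProd w u :=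
  Finset.sum_congr rfl fun _ _ => real_inner_comm _ _

theorem innerProd_smul_left (c : ℝ) (u w : V → Plane) :
    innerProd (c • u) w = c * innerProd u w := by
  simp [innerProd, inner_smul_left, Finset.mul_sum]

theorem innerProd_sub_left (u u' w : V → Plane) :
    innerProd (u - u') w = innerProd u w - innerProd u' w := by
  simp [innerProd, inner_sub_left, Finset.sum_sub_distrib]

theorem norm_sq_le_innerProd (u : V → Plane) : ‖u‖ ^ 2 ≤ innerProd u u := by
  have h : ‖u‖ ≤ √(innerProd u u) := by
    rw [pi_norm_le_iff_of_nonneg (Real.sqrt_nonneg _)]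
    intro i
    apply Real.le_sqrt_of_sq_le
    rw [← real_inner_self_eq_norm_sq]
    exact Finset.single_le_sum (f := fun i => ⟪u i, u i⟫) (fun _ _ => real_inner_self_nonneg)
      (Finset.mem_univ i)
  calc ‖u‖ ^ 2 ≤ √(innerProd u u) ^ 2 := by gcongr
    _ = _ := Real.sq_sqrt (innerProd_self_nonneg u)

theorem abs_innerProd_le (u w : V → Plane) :
    |innerProd u w| ≤ Fintype.card V * (‖u‖ * ‖w‖) := by
  calc |innerProd u w| ≤ ∑ i, |⟪u i, w i⟫| := Finset.abs_sum_le_sum_abs _ _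
    _ ≤ ∑ _i : V, ‖u‖ * ‖w‖ := Finset.sum_le_sum fun i _ =>
        (abs_real_inner_le_norm _ _).trans
          (mul_le_mul (norm_le_pi_norm u i) (norm_le_pi_norm w i) (norm_nonneg _) (norm_nonneg _))
    _ = _ := by simp

theorem innerProd_self_le (u : V → Plane) :
    innerProd u u ≤ Fintype.card V * ‖u‖ ^ 2 := by
  rw [sq]; exact (le_abs_self _).trans (abs_innerProd_le u u)

theorem innerProd_self_eq_zero {u : V → Plane} (h : innerProd u u = 0) : u = 0 := by
  have := norm_sq_le_innerProd u
  rw [h] at this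
  exact norm_eq_zero.1 (pow_eq_zero_iff two_ne_zero |>.1 (le_antisymm this (sq_nonneg _)))

theorem innerProd_le_young (u w : V → Plane) {τ : ℝ} (hτ : 0 < τ) :
    innerProd u w ≤ innerProd u u / (2 * τ) + τ / 2 * innerProd w w := by
  have h := innerProd_self_nonneg (u - τ • w)
  have e : innerProd (u - τ • w) (u - τ • w) =
      innerProd u u - 2 * τ * innerProd u w + τ ^ 2 * innerProd w w := by
    rw [innerProd_sub_left, innerProd_comm u (u - τ • w), innerProd_sub_left,
      innerProd_smul_left, innerProd_smul_left, innerProd_comm w (u - τ • w),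
      innerProd_sub_left, innerProd_smul_left, innerProd_comm w u]
    ring
  rw [e] at h
  have h2 : innerProd u u / (2 * τ) + τ / 2 * innerProd w w - innerProd u w =
      (innerProd u u - 2 * τ * innerProd u w + τ ^ 2 * innerProd w w) / (2 * τ) := by
    field_simp
    ring
  have := div_nonneg h (by positivity : 0 ≤ 2 * τ)
  linarith

variable {G : SimpleGraph V} {f : Sym2 V → ℝ → ℝ}

theorem vectorField_eq_zero {p : V → Plane} (h : ∀ u, virtualWork G f p u = 0) :
    vectorField G f p = 0 :=
  innerProd_self_eq_zero (by rw [innerProd_vectorField, h, neg_zero])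

/-- Near a critical configuration the potential deviates quadratically. -/
theorem exists_potential_sub_le (hf : ∀ e ∈ G.edgeSet, ContDiffOn ℝ 1 (f e) (Ioi 0))
    {p : V → Plane} (hp : p ∈ configSpace G) (hcrit : ∀ u, virtualWork G f p u = 0) :
    ∃ ρ > (0 : ℝ), ∃ L > (0 : ℝ), ∀ y, ‖y - p‖ < ρ →
      |potential G f y - potential G f p| ≤ L * ‖y - p‖ ^ 2 := by
  obtain ⟨K, hKpos, hK⟩ := (hasFDerivAt_vectorField hf hp).isBigO_sub.exists_pos
  rw [Asymptotics.isBigOWith_iff, vectorField_eq_zero hcrit] at hK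
  obtain ⟨ρ, hρ, hb⟩ := Metric.eventually_nhds_iff_ball.1
    (hK.and ((isOpen_configSpace G).mem_nhds hp))
  refine ⟨ρ, hρ, Fintype.card V * K + 1, by positivity, fun y hy => ?_⟩
  have hsub : Metric.closedBall p ‖y - p‖ ⊆ Metric.ball p ρ :=
    Metric.closedBall_subset_ball hy
  -- The gradient vanishes at `p` and is `O(‖y - p‖)` on this ball, so the mean value inequality
  -- yields a quadratic bound although the potential is only known to have a `C¹` gradient.
  have key := (convex_closedBall p ‖y - p‖).norm_image_sub_le_of_norm_hasFDerivWithin_le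
    (f := potential G f) (f' := workCLM G f) (C := Fintype.card V * K * ‖y - p‖)
    (fun x hx => (hasFDerivAt_potential hf (hb x (hsub hx)).2).hasFDerivWithinAt)
    (fun x hx => by
      refine ContinuousLinearMap.opNorm_le_bound _ (by positivity) fun u => ?_
      rw [workCLM_apply, ← neg_neg (virtualWork G f x u), ← innerProd_vectorField, norm_neg]
      refine (abs_innerProd_le _ _).trans ?_
      have h1 := (hb x (hsub hx)).1
      rw [sub_zero] at h1
      have h2 : ‖x - p‖ ≤ ‖y - p‖ := by simpa [dist_eq_norm] using hx
      calc (Fintype.card V : ℝ) * (‖vectorField G f x‖ * ‖u‖)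
          ≤ Fintype.card V * ((K * ‖y - p‖) * ‖u‖) := by
            gcongr
            exact h1.trans (by gcongr)
        _ = _ := by ring)
    (x := p) (y := y) (Metric.mem_closedBall_self (norm_nonneg _))
    (by simp [dist_eq_norm])
  rw [Real.norm_eq_abs] at key
  refine key.trans ?_
  have : 0 ≤ ‖y - p‖ ^ 2 := by positivity
  nlinarith

/-- Near a critical orbit the potential deviates quadratically in the distance to the orbit. -/
theorem exists_potential_sub_le_infDist (hf : ∀ e ∈ G.edgeSet, ContDiffOn ℝ 1 (f e) (Ioi 0))
    {p : V → Plane} (hp : p ∈ configSpace G) (hcrit : ∀ u, virtualWork G f p u = 0) :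
    ∃ ρ > (0 : ℝ), ∃ L > (0 : ℝ), ∀ x, Metric.infDist x (orbit p) < ρ →
      |potential G f x - potential G f p| ≤ L * Metric.infDist x (orbit p) ^ 2 := by
  obtain ⟨ρ, hρ, K, hK, h⟩ := exists_potential_sub_le hf hp hcrit
  refine ⟨ρ, hρ, K, hK, fun x hx => ?_⟩
  obtain ⟨q, hq, hxq⟩ := (isClosed_orbit p).exists_infDist_eq_dist ⟨p, self_mem_orbit p⟩ x
  -- A rigid motion carries the nearest point of the orbit to `p` and changes neither distances nor
  -- potential.
  obtain ⟨c, s, hcs, w, rfl⟩ := mem_orbit_iff_rigidAct.1 hq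
  obtain ⟨y, rfl⟩ := exists_rigidAct_eq hcs w x
  rw [dist_rigidAct hcs, dist_eq_norm] at hxq
  rw [hxq] at hx ⊢
  rw [potential_rigidAct hcs]
  exact h y hx

end Estimates

/-! ### Energy dissipation along solutions. -/

section Solutions

variable {V : Type u} [Fintype V] {G : SimpleGraph V} {f : Sym2 V → ℝ → ℝ}
  {x : ℝ → V → Plane} {T : ℝ}

theorem IsSolutionOn.hasDerivWithinAt_Ici (hx : IsSolutionOn G f x T) {t : ℝ}
    (ht : t ∈ Ico 0 T) : HasDerivWithinAt x (vectorField G f (x t)) (Ici t) t := by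
  refine (hx t ht).2.mono_of_mem_nhdsWithin ?_
  exact mem_of_superset (Ico_mem_nhdsGE ht.2) (Ico_subset_Ico_left ht.1)

theorem IsSolutionOn.continuousOn (hx : IsSolutionOn G f x T) : ContinuousOn x (Ico 0 T) :=
  fun t ht => (hx t ht).2.continuousWithinAt

/-- The displacement along a solution is controlled by the dissipated energy. -/
theorem IsSolutionOn.innerProd_sub_le (hf : ∀ e ∈ G.edgeSet, ContDiffOn ℝ 1 (f e) (Ioi 0))
    (hx : IsSolutionOn G f x T) {t : ℝ} (ht0 : 0 < t) (htT : t < T) :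
    innerProd (x t - x 0) (x t - x 0) ≤ t * (potential G f (x 0) - potential G f (x t)) := by
  set ξ := x t - x 0 with hξ
  have hmem : ∀ s ∈ Icc 0 t, s ∈ Ico 0 T := fun s hs => ⟨hs.1, hs.2.trans_lt htT⟩
  have hlin : ∀ {s : ℝ} {x' : V → Plane} {S : Set ℝ}, HasDerivWithinAt x x' S s →
      HasDerivWithinAt (fun s => innerProd ξ (x s)) (innerProd ξ x') S s := by
    intro s x' S h
    unfold innerProd
    exact HasDerivWithinAt.fun_sum fun i _ =>
      (innerSL ℝ (ξ i)).hasFDerivAt.comp_hasDerivWithinAt s ((hasDerivWithinAt_pi.1 h) i)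
  have hder : ∀ {s : ℝ} {x' : V → Plane} {S : Set ℝ}, s ∈ Ico 0 T → HasDerivWithinAt x x' S s →
      HasDerivWithinAt (fun s => innerProd ξ (x s) + t / 2 * potential G f (x s))
        (innerProd ξ x' + t / 2 * virtualWork G f (x s) x') S s := by
    intro s x' S hs h
    refine (hlin h).add (HasDerivWithinAt.const_mul _ ?_)
    have := (hasFDerivAt_potential hf (hx s hs).1).comp_hasDerivWithinAt s h
    rwa [workCLM_apply] at this
  -- Along the flow the derivative of `⟪ξ, x⟫ + (t/2) Φ(x)` is `⟪ξ, v⟫ - (t/2)‖v‖²`, which Young's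
  -- inequality bounds by `‖ξ‖²/(2t)`. Integration over `[0, t]` costs `‖ξ‖²/2`, half of the
  -- displacement term.
  have key := image_le_of_deriv_right_le_deriv_boundary
    (f := fun s => innerProd ξ (x s) + t / 2 * potential G f (x s))
    (f' := fun s => innerProd ξ (vectorField G f (x s)) +
      t / 2 * virtualWork G f (x s) (vectorField G f (x s)))
    (B := fun s => innerProd ξ (x 0) + t / 2 * potential G f (x 0)
      + innerProd ξ ξ / (2 * t) * s)
    (B' := fun _ => innerProd ξ ξ / (2 * t)) (a := 0) (b := t)
    (fun s hs => ((hder (hmem s hs) (hx s (hmem s hs)).2).continuousWithinAt).mono hmem)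
    (fun s hs => hder (hmem s (Ico_subset_Icc_self hs))
      (hx.hasDerivWithinAt_Ici (hmem s (Ico_subset_Icc_self hs))))
    (by simp)
    (by fun_prop)
    (fun s _ => by
      simpa using (((hasDerivAt_id s).const_mul (innerProd ξ ξ / (2 * t))).const_add
        (innerProd ξ (x 0) + t / 2 * potential G f (x 0))).hasDerivWithinAt)
    (fun s hs => by
      have h1 := innerProd_le_young ξ (vectorField G f (x s)) ht0
      have h2 := innerProd_vectorField G f (x s) (vectorField G f (x s))
      have h3 : virtualWork G f (x s) (vectorField G f (x s)) =
        -innerProd (vectorField G f (x s)) (vectorField G f (x s)) := by linarith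
      simp only [h3]
      linarith)
    (right_mem_Icc.2 ht0.le)
  have e1 : innerProd ξ ξ = innerProd ξ (x t) - innerProd ξ (x 0) := by
    conv_lhs => rw [hξ]
    rw [innerProd_sub_left, innerProd_comm _ ξ, innerProd_comm _ ξ]
  have e2 : innerProd ξ ξ / (2 * t) * t = innerProd ξ ξ / 2 := by field_simp
  simp only [e2] at key
  linarith

end Solutions

/-! ### Exponential stability implies positivity of the Hessian form -/

section Existence

open scoped NNReal in
/-- Solutions of a `C¹` equation that start close to an equilibrium exist, and stay close to
the equilibrium, for any prescribed time. -/
theorem exists_solution_near_equilibrium {E : Type*} [NormedAddCommGroup E] [NormedSpace ℝ E]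
    [FiniteDimensional ℝ E] {v : E → E} {U : Set E} (hU : IsOpen U)
    (hv : ∀ x ∈ U, ContDiffAt ℝ 1 v x) {p : E} (hp : p ∈ U) (hvp : v p = 0) {T : ℝ}
    (hT : 0 < T) :
    ∃ η > (0 : ℝ), ∀ x₀, dist x₀ p < η → ∃ x : ℝ → E, x 0 = x₀ ∧
      ∀ t ∈ Icc 0 T, x t ∈ U ∧ HasDerivWithinAt x (v (x t)) (Icc 0 T) t := by
  have : CompleteSpace E := FiniteDimensional.complete ℝ E
  have : ProperSpace E := FiniteDimensional.proper_real E
  obtain ⟨ρ, hρ, hball⟩ := Metric.nhds_basis_closedBall.mem_iff.1 (hU.mem_nhds hp)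
  -- Cutting the field off near `p` makes it globally bounded and Lipschitz, so Picard–Lindelöf
  -- reaches any time; the Grönwall bound then keeps the solution where the cutoff equals one.
  let χ : ContDiffBump p := ⟨ρ / 2, ρ, by positivity, by linarith⟩
  let w : E → E := fun x => χ x • v x
  have hsupp : tsupport w ⊆ Metric.closedBall p ρ := by
    refine (closure_mono (Function.support_smul_subset_left _ _)).trans ?_
    exact χ.tsupport_eq.subset
  have hw : ContDiff ℝ 1 w := by
    rw [contDiff_iff_contDiffAt]
    intro x
    by_cases hx : x ∈ tsupport w
    · exact χ.contDiffAt.smul (hv x (hball (hsupp hx)))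
    · have : w =ᶠ[𝓝 x] fun _ => 0 := notMem_tsupport_iff_eventuallyEq.1 hx
      exact contDiffAt_const.congr_of_eventuallyEq this
  have hwc : HasCompactSupport w :=
    (isCompact_closedBall p ρ).of_isClosed_subset (isClosed_tsupport w) hsupp
  obtain ⟨K, hK⟩ := ContDiff.lipschitzWith_of_hasCompactSupport hwc hw one_ne_zero
  obtain ⟨M, hM⟩ := hw.continuous.bounded_above_of_compact_support hwc
  have hM0 : 0 ≤ M := (norm_nonneg _).trans (hM p)
  have hwp : w p = 0 := by simp [w, hvp]
  have hin : ∀ x ∈ Metric.closedBall p (ρ / 2), w x = v x := fun x hx => by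
    simp [w, χ.one_of_mem_closedBall hx]
  -- The Grönwall factor up to time `T` is at most `exp (K * T)`, so these initial data stay within
  -- `ρ / 2` of `p`.
  refine ⟨ρ / 2 * Real.exp (-(K * T)), by positivity, fun x₀ hx₀ => ?_⟩
  have hPL : IsPicardLindelof (fun _ => w) (tmin := 0) (tmax := T) ⟨0, le_rfl, hT.le⟩ x₀
      (⟨M, hM0⟩ * ⟨T, hT.le⟩) 0 ⟨M, hM0⟩ K :=
    { lipschitzOnWith := fun _ _ => hK.lipschitzOnWith
      continuousOn := fun _ _ => continuousOn_const
      norm_le := fun _ _ x _ => hM x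
      mul_max_le := by
        simp only [sub_zero, sub_self, NNReal.coe_zero, max_eq_left hT.le]
        exact le_rfl }
  obtain ⟨x, hx0, hx⟩ := hPL.exists_eq_forall_mem_Icc_hasDerivWithinAt₀
  have hIci : ∀ t ∈ Ico 0 T, Icc 0 T ∈ 𝓝[Ici t] t := fun t ht =>
    mem_of_superset (Icc_mem_nhdsGE ht.2) (Icc_subset_Icc_left ht.1)
  have hdist : ∀ t ∈ Icc 0 T, x t ∈ Metric.closedBall p (ρ / 2) := by
    intro t ht
    have h := dist_le_of_trajectories_ODE (v := fun _ => w) (K := K) (g := fun _ => p)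
      (δ := dist x₀ p) (a := 0) (b := T) (fun _ => hK)
      (fun t ht => (hx t ht).continuousWithinAt)
      (fun t ht => (hx t (Ico_subset_Icc_self ht)).mono_of_mem_nhdsWithin (hIci t ht))
      continuousOn_const (fun t _ => by rw [hwp]; exact hasDerivWithinAt_const _ _ _)
      (by rw [← hx0]) t ht
    rw [Metric.mem_closedBall]
    refine h.trans ?_
    have h1 : Real.exp (K * (t - 0)) ≤ Real.exp (K * T) := by
      apply Real.exp_le_exp.2
      rw [sub_zero]
      exact mul_le_mul_of_nonneg_left ht.2 K.2
    calc dist x₀ p * Real.exp (K * (t - 0))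
        ≤ (ρ / 2 * Real.exp (-(K * T))) * Real.exp (K * T) := by gcongr
      _ = ρ / 2 := by rw [mul_assoc, ← Real.exp_add]; simp
  refine ⟨x, hx0, fun t ht => ⟨hball ?_, ?_⟩⟩
  · exact Metric.closedBall_subset_closedBall (by linarith) (hdist t ht)
  · rw [← hin _ (hdist t ht)]
    exact hx t ht

end Existence

section System

variable {V : Type u} [Fintype V] {G : SimpleGraph V} {f : Sym2 V → ℝ → ℝ}

/-- A displacement that is not an infinitesimal rigid motion leaves the orbit at linear speed. -/
theorem exists_le_infDist_orbit {p u : V → Plane} {i j : V} (hij : p i ≠ p j)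
    (hu : ¬ IsRigidOn p univ u) :
    ∃ m > (0 : ℝ), ∀ᶠ ε in 𝓝[>] (0 : ℝ), m * ε ≤ Metric.infDist (p + ε • u) (orbit p) := by
  rw [isRigidOn_univ_iff] at hu
  set S := LinearMap.range (motion p)
  have hne : (S : Set (V → Plane)).Nonempty := ⟨0, S.zero_mem⟩
  have hm : 0 < Metric.infDist u (S : Set (V → Plane)) := by
    rw [← (Submodule.closed_of_finiteDimensional S).notMem_iff_infDist_pos hne]
    exact hu
  set m := Metric.infDist u (S : Set (V → Plane))
  have hd : 0 < ‖p i - p j‖ := norm_pos_iff.2 (sub_ne_zero.2 hij)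
  set d := ‖p i - p j‖
  refine ⟨m / 2, by positivity, ?_⟩
  have hsmall : ∀ᶠ ε in 𝓝[>] (0 : ℝ),
      2 * (m / 2 + ‖u‖) ^ 2 * ‖p‖ / d ^ 2 * ε < m / 2 := by
    have : Tendsto (fun ε : ℝ => 2 * (m / 2 + ‖u‖) ^ 2 * ‖p‖ / d ^ 2 * ε) (𝓝 0)
        (𝓝 (2 * (m / 2 + ‖u‖) ^ 2 * ‖p‖ / d ^ 2 * 0)) := tendsto_id.const_mul _
    rw [mul_zero] at this
    exact (this.mono_left nhdsWithin_le_nhds).eventually_lt_const (by positivity)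
  filter_upwards [hsmall, self_mem_nhdsWithin] with ε hε hε0
  rw [mem_Ioi] at hε0
  rw [Metric.le_infDist ⟨p, self_mem_orbit p⟩]
  intro q hq
  by_contra! hlt
  obtain ⟨c, s, hcs, w, rfl⟩ := mem_orbit_iff_rigidAct.1 hq
  set q := rigidAct c s w p with hqdef
  rw [dist_eq_norm] at hlt
  have hqp : ‖q - p‖ ≤ (m / 2 + ‖u‖) * ε := by
    calc ‖q - p‖ = ‖ε • u - (p + ε • u - q)‖ := by congr 1; abel
      _ ≤ ‖ε • u‖ + ‖p + ε • u - q‖ := norm_sub_le _ _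
      _ ≤ ε * ‖u‖ + m / 2 * ε := by
        rw [norm_smul, Real.norm_of_nonneg hε0.le]; gcongr
      _ = _ := by ring
  have hα : 0 ≤ 1 - c := by nlinarith [sq_nonneg s]
  -- For a rotation, `‖(c - 1) z + s J z‖² = 2 (1 - c) ‖z‖²`. Hence `1 - c` is quadratic in `‖q -
  -- p‖`, that is, of order `ε²`.
  have hrot : 2 * (1 - c) * d ^ 2 ≤ (2 * ‖q - p‖) ^ 2 := by
    have e : (q i - q j) - (p i - p j) = (c - 1) • (p i - p j) + s • rot90 (p i - p j) := by
      rw [hqdef, rigidAct_sub, sub_smul, one_smul]; abel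
    have h1 : ‖(q i - q j) - (p i - p j)‖ ^ 2 = 2 * (1 - c) * d ^ 2 := by
      rw [e, norm_sq_rotation]
      linear_combination d ^ 2 * hcs
    rw [← h1]
    gcongr
    calc ‖(q i - q j) - (p i - p j)‖ = ‖(q - p) i - (q - p) j‖ := by
          congr 1; simp only [Pi.sub_apply]; abel
      _ ≤ ‖(q - p) i‖ + ‖(q - p) j‖ := norm_sub_le _ _
      _ ≤ ‖q - p‖ + ‖q - p‖ := add_le_add (norm_le_pi_norm _ i) (norm_le_pi_norm _ j)
      _ = _ := by ring
  have hα2 : (1 - c) * ‖p‖ < m / 2 * ε := by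
    have h1 : (1 - c) ≤ 2 * ((m / 2 + ‖u‖) * ε) ^ 2 / d ^ 2 := by
      rw [le_div_iff₀ (by positivity)]
      have : ‖q - p‖ ^ 2 ≤ ((m / 2 + ‖u‖) * ε) ^ 2 := by gcongr
      nlinarith
    calc (1 - c) * ‖p‖ ≤ 2 * ((m / 2 + ‖u‖) * ε) ^ 2 / d ^ 2 * ‖p‖ := by gcongr
      _ = 2 * (m / 2 + ‖u‖) ^ 2 * ‖p‖ / d ^ 2 * ε * ε := by ring
      _ < m / 2 * ε := by gcongr
  -- Up to the quadratic error `(1 - c) p`, the orbit point differs from `p` by an infinitesimal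
  -- motion, from which `ε u` has distance at least `m ε`.
  have hmot : q - p = motion p (w, s) - (1 - c) • p := by
    ext1 k
    simp only [hqdef, rigidAct, Pi.sub_apply, motion_apply, Pi.smul_apply, sub_smul, one_smul]
    abel
  have hS : m * ε ≤ ‖ε • u - motion p (w, s)‖ := by
    have hmem : (ε⁻¹ • motion p (w, s)) ∈ (S : Set (V → Plane)) :=
      S.smul_mem _ ⟨_, rfl⟩
    have h1 : m ≤ dist u (ε⁻¹ • motion p (w, s)) := Metric.infDist_le_dist_of_mem hmem
    have h2 : ε • u - motion p (w, s) = ε • (u - ε⁻¹ • motion p (w, s)) := by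
      rw [smul_sub, smul_inv_smul₀ hε0.ne']
    rw [h2, norm_smul, Real.norm_of_nonneg hε0.le, mul_comm, ← dist_eq_norm]
    gcongr
  have hfin : ‖ε • u - motion p (w, s)‖ ≤ ‖p + ε • u - q‖ + (1 - c) * ‖p‖ := by
    calc ‖ε • u - motion p (w, s)‖ = ‖(p + ε • u - q) - (1 - c) • p‖ := by
          congr 1
          rw [show p + ε • u - q = ε • u - (q - p) by abel, hmot]
          abel
      _ ≤ ‖p + ε • u - q‖ + ‖(1 - c) • p‖ := norm_sub_le _ _
      _ = _ := by rw [norm_smul, Real.norm_of_nonneg hα]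
  linarith

/-- Second-order expansion of the potential function along a direction in which the Hessian form
is not positive. -/
theorem eventually_potential_sub_le (hf : ∀ e ∈ G.edgeSet, ContDiffOn ℝ 1 (f e) (Ioi 0))
    {p u : V → Plane} (hp : p ∈ configSpace G) (hcrit : ∀ u, virtualWork G f p u = 0)
    (hu : hessForm G f p u u ≤ 0) {η : ℝ} (hη : 0 < η) :
    ∀ᶠ ε in 𝓝[>] (0 : ℝ), potential G f (p + ε • u) - potential G f p ≤ η * ε ^ 2 := by
  have hline : ∀ ε : ℝ, HasDerivAt (fun ε : ℝ => p + ε • u) u ε := fun ε => by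
    simpa using ((hasDerivAt_id ε).smul_const u).const_add p
  have hg : HasDerivAt (fun ε : ℝ => virtualWork G f (p + ε • u) u) (hessForm G f p u u) 0 := by
    have hv : HasDerivAt (fun ε : ℝ => vectorField G f (p + ε • u)) (fieldDeriv G f p u) 0 := by
      refine HasFDerivAt.comp_hasDerivAt (l := vectorField G f) (0 : ℝ) ?_ (hline 0)
      rw [zero_smul, add_zero]
      exact hasFDerivAt_vectorField hf hp
    have h1 : HasDerivAt (fun ε : ℝ => innerProd u (vectorField G f (p + ε • u)))
        (innerProd u (fieldDeriv G f p u)) 0 := by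
      unfold innerProd
      exact HasDerivAt.fun_sum fun i _ =>
        (innerSL ℝ (u i)).hasFDerivAt.comp_hasDerivAt 0 ((hasDerivAt_pi.1 hv) i)
    have h2 := h1.neg
    rw [innerProd_comm, innerProd_fieldDeriv, neg_neg] at h2
    convert! h2 using 1
    ext ε
    rw [Pi.neg_apply, innerProd_comm, innerProd_vectorField, neg_neg]
  have hg0 : virtualWork G f (p + (0 : ℝ) • u) u = 0 := by rw [zero_smul, add_zero, hcrit]
  have hlit := (hasDerivAt_iff_isLittleO.1 hg).def hη
  have hcfg : ∀ᶠ ε in 𝓝 (0 : ℝ), p + ε • u ∈ configSpace G := by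
    apply (hline 0).continuousAt.eventually_mem
    rw [zero_smul, add_zero]
    exact (isOpen_configSpace G).mem_nhds hp
  obtain ⟨ε₀, hε₀, hball⟩ := Metric.eventually_nhds_iff_ball.1 (hlit.and hcfg)
  filter_upwards [Ioo_mem_nhdsGT hε₀] with ε hε
  have hmem : ∀ s ∈ Icc 0 ε, s ∈ Metric.ball (0 : ℝ) ε₀ := fun s hs => by
    rw [mem_ball_zero_iff, Real.norm_of_nonneg hs.1]
    exact hs.2.trans_lt hε.2
  have hder : ∀ s ∈ Icc 0 ε, HasDerivAt (fun s : ℝ => potential G f (p + s • u))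
      (virtualWork G f (p + s • u) u) s := fun s hs => by
    have := (hasFDerivAt_potential hf (hball s (hmem s hs)).2).comp_hasDerivAt s (hline s)
    rwa [workCLM_apply] at this
  -- By first-order expansion of the gradient at `p`, the slope at `s` is at most `s * hessForm G f
  -- p u u + η * s`, hence at most `2 * η * s`, the derivative of `η * s ^ 2`.
  have key := image_le_of_deriv_right_le_deriv_boundary
    (f := fun s => potential G f (p + s • u)) (f' := fun s => virtualWork G f (p + s • u) u)
    (B := fun s => potential G f p + η * s ^ 2) (B' := fun s => η * (2 * s)) (a := 0) (b := ε)
    (fun s hs => (hder s hs).continuousAt.continuousWithinAt)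
    (fun s hs => (hder s (Ico_subset_Icc_self hs)).hasDerivWithinAt)
    (by simp) (by fun_prop)
    (fun s _ => by
      simpa using (((hasDerivAt_pow 2 s).const_mul η).const_add (potential G f p)).hasDerivWithinAt)
    (fun s hs => by
      have h := (hball s (hmem s (Ico_subset_Icc_self hs))).1
      rw [hg0, sub_zero, sub_zero, Real.norm_eq_abs, Real.norm_of_nonneg hs.1, smul_eq_mul] at h
      have h1 := (abs_le.1 h).2
      have h2 : s * hessForm G f p u u ≤ 0 := mul_nonpos_of_nonneg_of_nonpos hs.1 hu
      have h3 : 0 ≤ η * s := mul_nonneg hη.le hs.1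
      linarith)
    (right_mem_Icc.2 hε.1.le)
  linarith

/-- If the form is nonpositive on a nonrigid `u`, start at `p + ε u`, at distance `D` of order `ε`
from the orbit. Stability forces the solution to cover at least `D / 2` in a fixed time `τ`, which
dissipates energy at least `D² / (4 τ)`. Yet the initial energy exceeds that of `p` by only a small
multiple of `ε²`, and the final energy is at most `O(D'²)` below it, with `D'` exponentially small
relative to `D`. -/
theorem IsExponentiallyStable.hessForm_pos
    (hf : ∀ e ∈ G.edgeSet, ContDiffOn ℝ 1 (f e) (Ioi 0)) {p : V → Plane}
    (hp : IsCriticalOrbit G f p) {i j : V} (hij : p i ≠ p j)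
    (hstab : IsExponentiallyStable G f p) {u : V → Plane} (hu : ¬ IsRigidOn p univ u) :
    0 < hessForm G f p u u := by
  rw [isCriticalOrbit_iff hf] at hp
  obtain ⟨hp, hcrit⟩ := hp
  by_contra! hneg
  obtain ⟨δ, hδ, C, hC, r, hr, hst⟩ := hstab
  obtain ⟨ρ, hρ, L, hL, hquad⟩ := exists_potential_sub_le_infDist hf hp hcrit
  obtain ⟨m, hm, hlow⟩ := exists_le_infDist_orbit hij hu
  -- The time is fixed before `ε`. The second condition asks that `τ * exp (-2 r τ)` be small:
  -- exponential decay beats the factor `1 / τ` lost in the dissipation estimate.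
  obtain ⟨τ, hτ, hτ1, hτ2⟩ : ∃ τ > (0 : ℝ), C * Real.exp (-r * τ) ≤ 1 / 2 ∧
      L * (C * Real.exp (-r * τ)) ^ 2 ≤ 1 / (8 * τ) := by
    have hlim0 : Tendsto (fun τ : ℝ => r * τ) atTop atTop := tendsto_id.const_mul_atTop hr
    have hlim1 : Tendsto (fun τ : ℝ => C * Real.exp (-(r * τ))) atTop (𝓝 (C * 0)) :=
      (Real.tendsto_exp_neg_atTop_nhds_zero.comp hlim0).const_mul C
    have hlim2 : Tendsto (fun τ : ℝ => (r * τ) ^ 1 * Real.exp (-(r * τ))) atTop (𝓝 0) :=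
      (Real.tendsto_pow_mul_exp_neg_atTop_nhds_zero 1).comp hlim0
    have hlim3 := (hlim1.mul hlim2).const_mul (8 * L * C / r)
    rw [mul_zero] at hlim1
    rw [mul_zero, mul_zero] at hlim3
    obtain ⟨τ, h1, h2, h3⟩ := ((hlim1.eventually_lt_const (show (0 : ℝ) < 1 / 2 by norm_num)).and
      ((hlim3.eventually_lt_const one_pos).and (eventually_gt_atTop 0))).exists
    refine ⟨τ, h3, by rw [neg_mul]; exact h1.le, ?_⟩
    rw [le_div_iff₀ (by positivity), neg_mul]
    refine le_trans (le_of_eq ?_) h2.le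
    field_simp
  -- The stability estimate holds on half-open intervals, so existence beyond `τ` is needed to
  -- evaluate it at `τ`.
  obtain ⟨η, hη, hsol⟩ := exists_solution_near_equilibrium (isOpen_configSpace G)
    (fun x hx => contDiffAt_vectorField hf hx) hp (vectorField_eq_zero hcrit)
    (show 0 < τ + 1 by linarith)
  have hup := eventually_potential_sub_le hf hp hcrit hneg
    (show 0 < m ^ 2 / (16 * τ) by positivity)
  have hsmall : ∀ᶠ ε in 𝓝[>] (0 : ℝ), ε * ‖u‖ < min (min δ ρ) η := by
    have : Tendsto (fun ε : ℝ => ε * ‖u‖) (𝓝 0) (𝓝 (0 * ‖u‖)) := tendsto_id.mul_const _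
    rw [zero_mul] at this
    exact (this.mono_left nhdsWithin_le_nhds).eventually_lt_const
      (lt_min (lt_min hδ hρ) hη)
  obtain ⟨ε, hlow, hup, hsmall, hε⟩ :=
    (hlow.and (hup.and (hsmall.and self_mem_nhdsWithin))).exists
  rw [lt_min_iff, lt_min_iff] at hsmall
  obtain ⟨⟨hsδ, hsρ⟩, hsη⟩ := hsmall
  have hd0 : dist (p + ε • u) p = ε * ‖u‖ := by
    rw [dist_eq_norm, add_sub_cancel_left, norm_smul, Real.norm_of_nonneg hε.le]
  obtain ⟨x, hx0, hx⟩ := hsol (p + ε • u) (by rwa [hd0])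
  have hxs : IsSolutionOn G f x (τ + 1) := fun t ht =>
    ⟨(hx t (Ico_subset_Icc_self ht)).1,
      (hx t (Ico_subset_Icc_self ht)).2.mono Ico_subset_Icc_self⟩
  set D := Metric.infDist (p + ε • u) (orbit p) with hD
  have hDle : D ≤ ε * ‖u‖ := hd0 ▸ Metric.infDist_le_dist_of_mem (self_mem_orbit p)
  have hdec := hst (τ + 1) (by linarith) x hxs (by rw [hx0]; exact hDle.trans_lt hsδ) τ
    ⟨hτ.le, by linarith⟩
  rw [hx0, ← hD] at hdec
  have hD0 : 0 ≤ D := Metric.infDist_nonneg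
  set D' := Metric.infDist (x τ) (orbit p) with hD'
  have hD'0 : 0 ≤ D' := Metric.infDist_nonneg
  have hhalf : D' ≤ 1 / 2 * D := hdec.trans (by gcongr)
  have hquad := (abs_le.1 (hquad (x τ) (by rw [← hD']; linarith))).1
  rw [← hD'] at hquad
  have hdisp := hxs.innerProd_sub_le hf hτ (by linarith)
  rw [hx0] at hdisp
  have hnorm : D / 2 ≤ ‖x τ - (p + ε • u)‖ := by
    have := Metric.infDist_le_infDist_add_dist (s := orbit p) (x := p + ε • u) (y := x τ)
    rw [dist_comm, dist_eq_norm] at this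
    linarith
  have h1 : (D / 2) ^ 2 ≤ τ * (potential G f (p + ε • u) - potential G f (x τ)) :=
    ((pow_le_pow_left₀ (by positivity) hnorm 2).trans (norm_sq_le_innerProd _)).trans hdisp
  have h2 : L * D' ^ 2 ≤ 1 / (8 * τ) * D ^ 2 := by
    calc L * D' ^ 2 ≤ L * (C * Real.exp (-r * τ) * D) ^ 2 := by gcongr
      _ = L * (C * Real.exp (-r * τ)) ^ 2 * D ^ 2 := by ring
      _ ≤ _ := by gcongr
  have h3 : (m * ε) ^ 2 ≤ D ^ 2 := by gcongr
  have h4 : potential G f (p + ε • u) - potential G f (x τ) ≤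
      m ^ 2 / (16 * τ) * ε ^ 2 + 1 / (8 * τ) * D ^ 2 := by linarith
  have h5 : (D / 2) ^ 2 ≤ τ * (m ^ 2 / (16 * τ) * ε ^ 2 + 1 / (8 * τ) * D ^ 2) :=
    h1.trans (by gcongr)
  have h6 : τ * (m ^ 2 / (16 * τ) * ε ^ 2 + 1 / (8 * τ) * D ^ 2) =
      (m * ε) ^ 2 / 16 + D ^ 2 / 8 := by field_simp
  -- The inequalities now give `D² / 4 ≤ D² / 16 + D² / 8` with `D > 0`, a contradiction.
  have h7 : 0 < (m * ε) ^ 2 := by positivity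
  rw [h6] at h5
  linarith

end System

/-! ### Positivity of the Hessian form implies exponential stability -/

section OrbitDistance

variable {V : Type u} [Fintype V]

/-- The squared distance of a configuration to the orbit of `p` for the Euclidean norm
on `(ℝ²)^V`. -/
def orbitDistSq (p x : V → Plane) : ℝ :=
  Metric.infDist (WithLp.toLp 2 x) (WithLp.ofLp (p := 2) (V := V → Plane) ⁻¹' orbit p) ^ 2

theorem dist_toLp_sq (x q : V → Plane) :
    dist (WithLp.toLp 2 x) (WithLp.toLp 2 q) ^ 2 = innerProd (x - q) (x - q) := by
  rw [dist_eq_norm, ← WithLp.toLp_sub, PiLp.norm_sq_eq_of_L2]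
  simp [innerProd]

theorem continuous_orbitDistSq (p : V → Plane) : Continuous (orbitDistSq p) :=
  ((Metric.continuous_infDist_pt _).comp (PiLp.continuous_toLp 2 _)).pow 2

theorem orbitDistSq_le {p q : V → Plane} (x : V → Plane) (hq : q ∈ orbit p) :
    orbitDistSq p x ≤ innerProd (x - q) (x - q) := by
  rw [← dist_toLp_sq]
  exact pow_le_pow_left₀ Metric.infDist_nonneg (Metric.infDist_le_dist_of_mem (by simpa)) 2

theorem exists_orbitDistSq_eq (p x : V → Plane) :
    ∃ q ∈ orbit p, orbitDistSq p x = innerProd (x - q) (x - q) := by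
  obtain ⟨q, hq, h⟩ := ((isClosed_orbit p).preimage
    (PiLp.continuous_ofLp 2 _)).exists_infDist_eq_dist
    ⟨WithLp.toLp 2 p, self_mem_orbit p⟩ (WithLp.toLp 2 x)
  refine ⟨WithLp.ofLp q, hq, ?_⟩
  rw [← dist_toLp_sq]
  unfold orbitDistSq
  rw [h]

/-- Together with `orbitDistSq_le_infDist_sq`, this moves between the maximum-norm distance of the
stability definition and the Euclidean one, for which nearest points give orthogonality. -/
theorem infDist_sq_le_orbitDistSq (p x : V → Plane) :
    Metric.infDist x (orbit p) ^ 2 ≤ orbitDistSq p x := by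
  obtain ⟨q, hq, h⟩ := exists_orbitDistSq_eq p x
  rw [h]
  refine le_trans ?_ (norm_sq_le_innerProd _)
  rw [← dist_eq_norm]
  exact pow_le_pow_left₀ Metric.infDist_nonneg (Metric.infDist_le_dist_of_mem hq) 2

theorem orbitDistSq_le_infDist_sq (p x : V → Plane) :
    orbitDistSq p x ≤ Fintype.card V * Metric.infDist x (orbit p) ^ 2 := by
  obtain ⟨q, hq, h⟩ := (isClosed_orbit p).exists_infDist_eq_dist ⟨p, self_mem_orbit p⟩ x
  rw [h, dist_eq_norm]
  exact (orbitDistSq_le x hq).trans (innerProd_self_le _)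

theorem hasDerivWithinAt_innerProd_self {x : ℝ → V → Plane} {x' q : V → Plane} {S : Set ℝ} {t : ℝ}
    (h : HasDerivWithinAt x x' S t) :
    HasDerivWithinAt (fun s => innerProd (x s - q) (x s - q)) (2 * innerProd (x t - q) x') S t := by
  unfold innerProd
  rw [Finset.mul_sum]
  refine HasDerivWithinAt.fun_sum fun i _ => ?_
  have hi := ((hasDerivWithinAt_pi.1 h) i).sub_const (q i)
  have := hi.inner ℝ hi
  simp only [Pi.sub_apply]
  convert! this using 1
  rw [real_inner_comm (x t i - q i) (x' i)]
  ring

/-- The displacement from a nearest point of the orbit is orthogonal to the infinitesimal rigid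
motions. -/
theorem innerProd_motion_eq_zero {p y : V → Plane}
    (h : ∀ q ∈ orbit p, innerProd (y - p) (y - p) ≤ innerProd (y - q) (y - q)) (a : Plane × ℝ) :
    innerProd (y - p) (motion p a) = 0 := by
  -- A curve in the orbit through `p` with velocity `motion p a` at time zero; the squared distance
  -- to `y` is minimal there, so its derivative vanishes.
  set γ : ℝ → V → Plane := fun t => rigidAct (Real.cos (a.2 * t)) (Real.sin (a.2 * t)) (t • a.1) p
    with hγ
  have hγ0 : γ 0 = p := by
    ext1 i
    simp [hγ, rigidAct]
  have hder : HasDerivAt γ (motion p a) 0 := by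
    rw [hasDerivAt_pi]
    intro i
    have hlin : HasDerivAt (fun t : ℝ => a.2 * t) a.2 0 := by
      simpa using (hasDerivAt_id (0 : ℝ)).const_mul a.2
    have h1 := (hlin.cos.smul_const (p i)).add (hlin.sin.smul_const (rot90 (p i)))
    have h2 := h1.add ((hasDerivAt_id (0 : ℝ)).smul_const a.1)
    convert! h2 using 1
    simp [motion_apply, add_comm]
  have hd := hasDerivWithinAt_innerProd_self (q := y) hder.hasDerivWithinAt (S := univ)
  rw [hasDerivWithinAt_univ, hγ0] at hd
  have hswap : ∀ q : V → Plane, innerProd (q - y) (q - y) = innerProd (y - q) (y - q) := by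
    intro q
    simp only [innerProd, Pi.sub_apply]
    refine Finset.sum_congr rfl fun i _ => ?_
    rw [← neg_sub (y i), inner_neg_neg]
  have hmin : IsLocalMin (fun s => innerProd (γ s - y) (γ s - y)) 0 := by
    refine Filter.Eventually.of_forall fun t => ?_
    simp only [hγ0, hswap]
    exact h _ (rigidAct_mem_orbit (Real.cos_sq_add_sin_sq _) _ (self_mem_orbit p))
  have h0 := hmin.hasDerivAt_eq_zero hd
  have h1 : innerProd (y - p) (motion p a) = -innerProd (p - y) (motion p a) := by
    rw [innerProd_sub_left, innerProd_sub_left]; ring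
  linarith

theorem innerProd_rigidAct {c s : ℝ} (h : c ^ 2 + s ^ 2 = 1) (x y : V → Plane) :
    innerProd (rigidAct c s 0 x) (rigidAct c s 0 y) = innerProd x y := by
  refine Finset.sum_congr rfl fun i _ => ?_
  simp only [plane_inner_eq, rigidAct, PiLp.add_apply, PiLp.smul_apply, rot90_apply_zero,
    rot90_apply_one, smul_eq_mul, PiLp.zero_apply]
  linear_combination (x i 0 * y i 0 + x i 1 * y i 1) * h

end OrbitDistance

section System

variable {V : Type u} [Fintype V] {G : SimpleGraph V} {f : Sym2 V → ℝ → ℝ}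

/-- A nonzero vector orthogonal to all motions is not a motion, so the form has a positive minimum
on the compact unit sphere of the orthogonal complement; homogeneity does the rest. -/
theorem exists_mul_innerProd_le_hessForm {p : V → Plane} [Nonempty V]
    (hpos : ∀ u, ¬ IsRigidOn p univ u → 0 < hessForm G f p u u) :
    ∃ κ > (0 : ℝ), ∀ u, (∀ a, innerProd u (motion p a) = 0) →
      κ * innerProd u u ≤ hessForm G f p u u := by
  have hcard : 0 < (Fintype.card V : ℝ) := by exact_mod_cast Fintype.card_pos
  have hcont : Continuous fun u : V → Plane => hessForm G f p u u := by
    have : (fun u : V → Plane => hessForm G f p u u) =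
        fun u => -innerProd (fieldDeriv G f p u) u := by
      ext u; rw [innerProd_fieldDeriv, neg_neg]
    rw [this]
    unfold innerProd
    fun_prop
  have hclosed : IsClosed {u : V → Plane | ∀ a, innerProd u (motion p a) = 0} := by
    rw [ofPred_forall]
    refine isClosed_iInter fun a => isClosed_eq ?_ continuous_const
    unfold innerProd
    fun_prop
  have hK := (isCompact_sphere (0 : V → Plane) 1).inter_right hclosed
  obtain ⟨κ, hκ, hmin⟩ : ∃ κ > (0 : ℝ), ∀ u : V → Plane, ‖u‖ = 1 →
      (∀ a, innerProd u (motion p a) = 0) → κ ≤ hessForm G f p u u := by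
    rcases (Metric.sphere (0 : V → Plane) 1 ∩
      {u : V → Plane | ∀ a, innerProd u (motion p a) = 0}).eq_empty_or_nonempty with he | hne
    · refine ⟨1, one_pos, fun u h1 h2 => ?_⟩
      have : u ∈ (∅ : Set (V → Plane)) := he ▸ ⟨by simpa using h1, h2⟩
      exact this.elim
    · obtain ⟨u₀, hu₀, hm⟩ := hK.exists_isMinOn hne hcont.continuousOn
      refine ⟨hessForm G f p u₀ u₀, hpos u₀ fun hr => ?_, fun u h1 h2 =>
        hm ⟨by simpa using h1, h2⟩⟩
      obtain ⟨a, ha⟩ := isRigidOn_univ_iff.1 hr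
      have h0 := hu₀.2 a
      rw [ha] at h0
      have := hu₀.1
      rw [innerProd_self_eq_zero h0] at this
      simp at this
  refine ⟨κ / Fintype.card V, by positivity, fun u hu => ?_⟩
  by_cases h0 : u = 0
  · subst h0
    simp [innerProd, ← hessBilin_apply]
  have hn : 0 < ‖u‖ := norm_pos_iff.2 h0
  have h1 := hmin (‖u‖⁻¹ • u) (by rw [norm_smul, norm_inv, norm_norm, inv_mul_cancel₀ hn.ne'])
    (fun a => by rw [innerProd_smul_left, hu, mul_zero])
  rw [hessForm_smul_left, hessForm_smul_right, ← mul_assoc, ← sq, inv_pow,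
    inv_mul_eq_div, le_div_iff₀ (by positivity)] at h1
  refine le_trans ?_ h1
  rw [div_mul_eq_mul_div, div_le_iff₀ hcard, mul_assoc]
  have := innerProd_self_le u
  rw [mul_comm] at this
  gcongr

/-- The linear part contributes at most `-κ` times the squared displacement, and near `p` the
nonlinear remainder uses up only half of this margin. -/
theorem exists_innerProd_vectorField_le (hf : ∀ e ∈ G.edgeSet, ContDiffOn ℝ 1 (f e) (Ioi 0))
    {p : V → Plane} [Nonempty V] (hp : p ∈ configSpace G)
    (hcrit : ∀ u, virtualWork G f p u = 0)
    (hpos : ∀ u, ¬ IsRigidOn p univ u → 0 < hessForm G f p u u) :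
    ∃ κ > (0 : ℝ), ∃ ρ > (0 : ℝ), ∀ y, ‖y - p‖ < ρ →
      (∀ a, innerProd (y - p) (motion p a) = 0) →
      innerProd (y - p) (vectorField G f y) ≤ -(κ * innerProd (y - p) (y - p)) := by
  have hcard : 0 < (Fintype.card V : ℝ) := by exact_mod_cast Fintype.card_pos
  obtain ⟨κ, hκ, hlow⟩ := exists_mul_innerProd_le_hessForm hpos
  have hlit := (hasFDerivAt_iff_isLittleO.1 (hasFDerivAt_vectorField hf hp)).def
    (show 0 < κ / (2 * Fintype.card V) by positivity)
  obtain ⟨ρ, hρ, hball⟩ := Metric.eventually_nhds_iff_ball.1 hlit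
  refine ⟨κ / 2, by positivity, ρ, hρ, fun y hy horth => ?_⟩
  have h1 := hball y (by simpa [dist_eq_norm] using hy)
  rw [vectorField_eq_zero hcrit, sub_zero] at h1
  set R := vectorField G f y - fieldDeriv G f p (y - p) with hR
  have e : innerProd (y - p) (vectorField G f y) =
      -hessForm G f p (y - p) (y - p) + innerProd (y - p) R := by
    rw [← innerProd_fieldDeriv, innerProd_comm _ R, hR, innerProd_comm (y - p),
      innerProd_sub_left]
    ring
  have h2 : innerProd (y - p) R ≤ κ / 2 * innerProd (y - p) (y - p) := by
    calc innerProd (y - p) R ≤ Fintype.card V * (‖y - p‖ * ‖R‖) :=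
          (le_abs_self _).trans (abs_innerProd_le _ _)
      _ ≤ Fintype.card V * (‖y - p‖ * (κ / (2 * Fintype.card V) * ‖y - p‖)) := by gcongr
      _ = κ / 2 * ‖y - p‖ ^ 2 := by field_simp
      _ ≤ _ := by gcongr; exact norm_sq_le_innerProd _
  have h3 := hlow _ horth
  rw [e]
  linarith

/-- The squared Euclidean distance to the orbit is a Lyapunov function. It need not be
differentiable where the nearest point jumps, so a comparison theorem for one-sided slopes is used.
-/
theorem isExponentiallyStable_of_hessForm_pos
    (hf : ∀ e ∈ G.edgeSet, ContDiffOn ℝ 1 (f e) (Ioi 0)) {p : V → Plane} [Nonempty V]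
    (hp : IsCriticalOrbit G f p)
    (hpos : ∀ u, ¬ IsRigidOn p univ u → 0 < hessForm G f p u u) :
    IsExponentiallyStable G f p := by
  rw [isCriticalOrbit_iff hf] at hp
  obtain ⟨hp, hcrit⟩ := hp
  obtain ⟨κ, hκ, ρ, hρ, hdecay⟩ := exists_innerProd_vectorField_le hf hp hcrit hpos
  have hcard : 1 ≤ (Fintype.card V : ℝ) := by exact_mod_cast Fintype.card_pos
  set n : ℝ := (Fintype.card V : ℝ)
  choose near hnear hnear_eq using exists_orbitDistSq_eq p
  -- Equivariance moves the nearest point to `p`; the displacement is then orthogonal to the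
  -- motions, and the decay estimate at `p` applies uniformly along the orbit.
  have hrate : ∀ z, orbitDistSq p z < ρ ^ 2 →
      2 * innerProd (z - near z) (vectorField G f z) ≤ -(2 * κ * orbitDistSq p z) := by
    intro z hz
    obtain ⟨c, s, hcs, w, hq⟩ := mem_orbit_iff_rigidAct.1 (hnear z)
    obtain ⟨y, hy⟩ := exists_rigidAct_eq hcs w z
    have e1 : orbitDistSq p z = innerProd (y - p) (y - p) := by
      rw [hnear_eq, ← hq, ← hy, rigidAct_sub_rigidAct, innerProd_rigidAct hcs]
    have e2 : innerProd (z - near z) (vectorField G f z) =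
        innerProd (y - p) (vectorField G f y) := by
      rw [← hq, ← hy, rigidAct_sub_rigidAct, vectorField_rigidAct hcs, innerProd_rigidAct hcs]
    have hyp : ‖y - p‖ < ρ :=
      lt_of_pow_lt_pow_left₀ 2 hρ.le ((norm_sq_le_innerProd _).trans_lt (e1 ▸ hz))
    have horth := innerProd_motion_eq_zero (p := p) (y := y) fun q hq' => by
      rw [← e1]
      have := orbitDistSq_le z (rigidAct_mem_orbit hcs w hq')
      rwa [← hy, rigidAct_sub_rigidAct, innerProd_rigidAct hcs, hy] at this
    rw [e1, e2]
    linarith [hdecay y hyp horth]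
  -- The radius `ρ / n` absorbs the change of norm. The squared distance decays at the weakened rate
  -- `κ`, hence the distance at rate `κ / 2`.
  refine ⟨ρ / n, by positivity, n, by positivity, κ / 2, by positivity,
    fun T hT x hx hx0 t ht => ?_⟩
  set d := Metric.infDist (x 0) (orbit p) with hd
  have hd0 : 0 ≤ d := Metric.infDist_nonneg
  have hW0 : orbitDistSq p (x 0) ≤ n * d ^ 2 := orbitDistSq_le_infDist_sq p (x 0)
  have hW0ρ : n * d ^ 2 < ρ ^ 2 := by
    have h1 : d * n < ρ := (lt_div_iff₀ (by positivity)).1 hx0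
    calc n * d ^ 2 ≤ n * (n * d ^ 2) := le_mul_of_one_le_left (by positivity) hcard
      _ = (d * n) ^ 2 := by ring
      _ < ρ ^ 2 := by gcongr
  have hmem : ∀ s ∈ Icc 0 t, s ∈ Ico 0 T := fun s hs => ⟨hs.1, hs.2.trans_lt ht.2⟩
  -- The comparison needs a strict slope inequality at contact: `-2κB < -κB` requires `B > 0`, hence
  -- `M > 0`. This permits `d = 0` to be treated as a limit afterwards.
  have hbound : ∀ M, orbitDistSq p (x 0) ≤ M → 0 < M → M < ρ ^ 2 →
      orbitDistSq p (x t) ≤ M * Real.exp (-(κ * t)) := by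
    intro M hM hM0 hMρ
    refine image_le_of_liminf_slope_right_lt_deriv_boundary (f := fun s => orbitDistSq p (x s))
      (f' := fun s => 2 * innerProd (x s - near (x s)) (vectorField G f (x s)))
      (B := fun s => M * Real.exp (-(κ * s))) (B' := fun s => -(κ * (M * Real.exp (-(κ * s)))))
      (a := 0) (b := t) ?_ ?_ ?_ ?_ ?_ (right_mem_Icc.2 ht.1)
    · exact (continuous_orbitDistSq p).comp_continuousOn (hx.continuousOn.mono hmem)
    · intro s hs r hr
      have hder := hasDerivWithinAt_innerProd_self (q := near (x s))
        (hx.hasDerivWithinAt_Ici (hmem s (Ico_subset_Icc_self hs)))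
      have hlim := (hasDerivWithinAt_iff_tendsto_slope' (lt_irrefl s)).1 hder.Ioi_of_Ici
      -- Freezing the nearest point at time `s` bounds the later distance from above, with equality
      -- at `s`, so the slope is at most that of a differentiable function.
      refine Eventually.frequently ?_
      filter_upwards [hlim.eventually_lt_const hr, self_mem_nhdsWithin] with z hz hsz
      refine lt_of_le_of_lt ?_ hz
      rw [slope_def_field, slope_def_field]
      have hsz' : 0 < z - s := sub_pos.2 hsz
      gcongr
      · exact orbitDistSq_le _ (hnear _)
      · exact (hnear_eq _).ge
    · simpa using hM
    · intro s
      have h1 : HasDerivAt (fun s : ℝ => -(κ * s)) (-κ) s := by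
        simpa using (hasDerivAt_id s).const_mul (-κ)
      convert! h1.exp.const_mul M using 1
      ring
    · intro s hs heq
      have hB : 0 < M * Real.exp (-(κ * s)) := by positivity
      have hle : M * Real.exp (-(κ * s)) ≤ M :=
        mul_le_of_le_one_right hM0.le (Real.exp_le_one_iff.2 (by
          have := mul_nonneg hκ.le hs.1
          linarith))
      have h1 := hrate (x s) (by rw [heq]; exact hle.trans_lt hMρ)
      rw [heq] at h1
      have h2 : 0 < κ * (M * Real.exp (-(κ * s))) := by positivity
      linarith
  have hfinal : orbitDistSq p (x t) ≤ n * d ^ 2 * Real.exp (-(κ * t)) := by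
    have hlim : Tendsto (fun M => M * Real.exp (-(κ * t))) (𝓝[>] (n * d ^ 2))
        (𝓝 (n * d ^ 2 * Real.exp (-(κ * t)))) :=
      (tendsto_id.mul_const _).mono_left nhdsWithin_le_nhds
    refine ge_of_tendsto hlim ?_
    filter_upwards [Ioo_mem_nhdsGT hW0ρ] with M hM
    exact hbound M (hW0.trans hM.1.le) (lt_of_le_of_lt (by positivity) hM.1) hM.2
  refine (pow_le_pow_iff_left₀ Metric.infDist_nonneg (by positivity) two_ne_zero).1 ?_
  refine (infDist_sq_le_orbitDistSq p (x t)).trans (hfinal.trans ?_)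
  have hexp : Real.exp (-(κ * t)) = Real.exp (-(κ / 2) * t) ^ 2 := by
    rw [← Real.exp_nat_mul]
    congr 1
    push_cast
    ring
  rw [hexp]
  calc n * d ^ 2 * Real.exp (-(κ / 2) * t) ^ 2
      ≤ n * (n * d ^ 2 * Real.exp (-(κ / 2) * t) ^ 2) :=
        le_mul_of_one_le_left (by positivity) hcard
    _ = _ := by ring

/-- A critical orbit is exponentially stable if and only if the Hessian form is positive transverse
to the infinitesimal rigid motions. -/
theorem isExponentiallyStable_iff (hf : ∀ e ∈ G.edgeSet, ContDiffOn ℝ 1 (f e) (Ioi 0))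
    {p : V → Plane} (hp : IsCriticalOrbit G f p) {i j : V} (hij : p i ≠ p j) :
    IsExponentiallyStable G f p ↔ ∀ u, ¬ IsRigidOn p univ u → 0 < hessForm G f p u u :=
  have : Nonempty V := ⟨i⟩
  ⟨fun h _ hu => h.hessForm_pos hf hp hij hu, isExponentiallyStable_of_hessForm_pos hf hp⟩

end System

/-! ### Combinatorics of the independent partition -/

section Partition

variable {V : Type u}

/-- For one edge, rigidity only says that its length is stationary: a relative velocity orthogonal
to the edge is a rotation. -/
theorem isRigidOn_pair_iff {p u : V → Plane} {j v : V} (h : p v ≠ p j) :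
    IsRigidOn p {j, v} u ↔ ⟪p v - p j, u v - u j⟫ = 0 := by
  constructor
  · rintro ⟨a, s, hu⟩
    rw [hu v (by simp), hu j (by simp), add_sub_add_left_eq_sub, ← smul_sub, ← map_sub,
      inner_smul_right, inner_rot90_self, mul_zero]
  · intro h0
    obtain ⟨s, hs⟩ := exists_smul_rot90_of_inner_eq_zero (sub_ne_zero.2 h) h0
    refine ⟨u j - s • rot90 (p j), s, ?_⟩
    rintro i (rfl | rfl)
    · abel
    · rw [map_sub, smul_sub, sub_eq_iff_eq_add] at hs
      rw [hs]
      abel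

theorem blockVerts_singleton (j v : V) : blockVerts {s(j, v)} = {j, v} := by
  ext i
  simp [blockVerts]

theorem blockVerts_insert {A : Set (Sym2 V)} {j k : V} (h : s(j, k) ∈ A) (v : V) :
    blockVerts (insert s(j, v) (insert s(k, v) A)) = insert v (blockVerts A) := by
  have hj : j ∈ blockVerts A := ⟨_, h, by simp⟩
  have hk : k ∈ blockVerts A := ⟨_, h, by simp⟩
  ext i
  constructor
  · rintro ⟨e, (rfl | rfl | he), hi⟩
    · rcases Sym2.mem_iff.1 hi with rfl | rfl
      · exact .inr hj
      · exact .inl rfl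
    · rcases Sym2.mem_iff.1 hi with rfl | rfl
      · exact .inr hk
      · exact .inl rfl
    · exact .inr ⟨e, he, hi⟩
  · rintro (rfl | ⟨e, he, hi⟩)
    · exact ⟨s(j, i), by simp, by simp⟩
    · exact ⟨e, .inr (.inr he), hi⟩

theorem area_ne_zero_of_not_collinear {a b c : Plane} (hab : c ≠ a)
    (h : ¬ Collinear ℝ {a, b, c}) : ⟪rot90 (c - a), c - b⟫ ≠ 0 := by
  intro h0
  apply h
  have := collinear_of_inner_rot90_eq_zero (c := b) hab (by
    rw [← neg_sub c a, ← neg_sub c b, map_neg, inner_neg_neg]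
    exact h0)
  convert this using 1
  ext x
  simp only [mem_insert_iff, mem_singleton_iff]
  tauto

namespace HennebergSeq

variable {p : V → Plane} {S : Set V} {E : Set (Sym2 V)}

theorem blockVerts_subset (c : HennebergSeq S E) : blockVerts E ⊆ S := by
  induction c with
  | base a b hab => exact (blockVerts_singleton a b).subset
  | add c v j k hv hjk ih =>
    rw [blockVerts_insert hjk]
    exact insert_subset_insert ih

theorem mem_left (c : HennebergSeq S E) {j k : V} (h : s(j, k) ∈ E) : j ∈ S :=
  c.blockVerts_subset ⟨_, h, by simp⟩

theorem mem_right (c : HennebergSeq S E) {j k : V} (h : s(j, k) ∈ E) : k ∈ S :=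
  c.blockVerts_subset ⟨_, h, by simp⟩

theorem ne_of_mem (c : HennebergSeq S E) : ∀ {i j : V}, s(i, j) ∈ E → i ≠ j := by
  induction c with
  | base a b hab =>
    rintro i j h rfl
    rw [mem_singleton_iff, Sym2.eq_iff] at h
    rcases h with ⟨rfl, rfl⟩ | ⟨rfl, rfl⟩ <;> exact hab rfl
  | add c v j k hv hjk ih =>
    rintro i l (h | h | h) rfl
    · rcases Sym2.eq_iff.1 h with ⟨rfl, rfl⟩ | ⟨rfl, rfl⟩ <;> exact hv (c.mem_left hjk)
    · rcases Sym2.eq_iff.1 h with ⟨rfl, rfl⟩ | ⟨rfl, rfl⟩ <;> exact hv (c.mem_right hjk)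
    · exact ih h rfl

/-- The class of the enlarged partition that comes from the class `A`, when the new vertex `v` is
aligned with `j` and `k`. -/
def enlarge (v j k : V) (A : Set (Sym2 V)) : Set (Sym2 V) :=
  open Classical in if s(j, k) ∈ A then insert s(j, v) (insert s(k, v) A) else A

theorem subset_enlarge (v j k : V) (A : Set (Sym2 V)) : A ⊆ enlarge v j k A := by
  unfold enlarge
  split_ifs
  · exact (subset_insert _ _).trans (subset_insert _ _)
  · exact subset_rfl

theorem enlarge_of_mem {v j k : V} {A : Set (Sym2 V)} (h : s(j, k) ∈ A) :
    enlarge v j k A = insert s(j, v) (insert s(k, v) A) := if_pos h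

theorem enlarge_of_notMem {v j k : V} {A : Set (Sym2 V)} (h : s(j, k) ∉ A) :
    enlarge v j k A = A := if_neg h

theorem independentPartition_add_of_collinear (c : HennebergSeq S E) {v j k : V} (hv : v ∉ S)
    (hjk : s(j, k) ∈ E) (h : Collinear ℝ {p j, p k, p v}) :
    (add c v j k hv hjk).independentPartition p = enlarge v j k '' c.independentPartition p := by
  rw [independentPartition, if_pos h]
  rfl

theorem independentPartition_add_of_not_collinear (c : HennebergSeq S E) {v j k : V} (hv : v ∉ S)
    (hjk : s(j, k) ∈ E) (h : ¬ Collinear ℝ {p j, p k, p v}) :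
    (add c v j k hv hjk).independentPartition p =
      c.independentPartition p ∪ {{s(j, v)}, {s(k, v)}} := by
  rw [independentPartition, if_neg h]

theorem sUnion_independentPartition (p : V → Plane) (c : HennebergSeq S E) :
    ⋃₀ c.independentPartition p = E := by
  induction c with
  | base a b hab => simp [independentPartition]
  | @add S E c v j k hv hjk ih =>
    by_cases h : Collinear ℝ {p j, p k, p v}
    · rw [independentPartition_add_of_collinear c hv hjk h]
      ext e
      constructor
      · rintro ⟨_, ⟨A, hA, rfl⟩, he⟩
        have hAE : A ⊆ E := fun e he => ih ▸ ⟨A, hA, he⟩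
        by_cases hjA : s(j, k) ∈ A
        · rw [enlarge_of_mem hjA] at he
          exact insert_subset_insert (insert_subset_insert hAE) he
        · rw [enlarge_of_notMem hjA] at he
          exact .inr (.inr (hAE he))
      · have hjk' := hjk
        rw [← ih] at hjk'
        obtain ⟨A, hA, hjA⟩ := hjk'
        rintro (rfl | rfl | he)
        · exact ⟨_, ⟨A, hA, rfl⟩, by rw [enlarge_of_mem hjA]; simp⟩
        · exact ⟨_, ⟨A, hA, rfl⟩, by rw [enlarge_of_mem hjA]; simp⟩
        · rw [← ih] at he
          obtain ⟨B, hB, heB⟩ := he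
          exact ⟨_, ⟨B, hB, rfl⟩, subset_enlarge _ _ _ _ heB⟩
    · rw [independentPartition_add_of_not_collinear c hv hjk h, sUnion_union, ih]
      ext e
      simp only [sUnion_insert, sUnion_singleton, mem_union, mem_insert_iff, mem_singleton_iff]
      tauto

theorem subset_of_mem_independentPartition (c : HennebergSeq S E) {A : Set (Sym2 V)}
    (hA : A ∈ c.independentPartition p) : A ⊆ E := fun e he => by
  rw [← c.sUnion_independentPartition p]
  exact ⟨A, hA, he⟩

theorem exists_mem_independentPartition (c : HennebergSeq S E) (p : V → Plane) {e : Sym2 V}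
    (he : e ∈ E) : ∃ A ∈ c.independentPartition p, e ∈ A := by
  rwa [← c.sUnion_independentPartition p] at he

theorem notMem_edges (c : HennebergSeq S E) {v : V} (hv : v ∉ S) (i : V) : s(i, v) ∉ E :=
  fun h => hv (c.mem_right h)

theorem mem_of_mem_enlarge {v j k : V} {A : Set (Sym2 V)} {e : Sym2 V} (hv : v ∉ e)
    (h : e ∈ enlarge v j k A) : e ∈ A := by
  by_cases hjA : s(j, k) ∈ A
  · rw [enlarge_of_mem hjA] at h
    rcases h with rfl | rfl | h
    · exact absurd (Sym2.mem_mk_right _ _) hv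
    · exact absurd (Sym2.mem_mk_right _ _) hv
    · exact h
  · rwa [enlarge_of_notMem hjA] at h

/-- The classes stay disjoint because edges at the new vertex are absent from all old classes, and
when `v` is aligned they enter only the class containing `s(j, k)`. -/
theorem independentPartition_unique (c : HennebergSeq S E) :
    ∀ {A B : Set (Sym2 V)} {e : Sym2 V}, A ∈ c.independentPartition p →
      B ∈ c.independentPartition p → e ∈ A → e ∈ B → A = B := by
  induction c with
  | base a b hab =>
    intro A B e hA hB _ _
    rw [independentPartition, mem_singleton_iff] at hA hB
    rw [hA, hB]
  | @add S E c v j k hv hjk ih =>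
    intro A B e hA hB heA heB
    by_cases h : Collinear ℝ {p j, p k, p v}
    · rw [independentPartition_add_of_collinear c hv hjk h] at hA hB
      obtain ⟨A, hA, rfl⟩ := hA
      obtain ⟨B, hB, rfl⟩ := hB
      congr 1
      by_cases hve : v ∈ e
      · have key : ∀ {C}, C ∈ c.independentPartition p → e ∈ enlarge v j k C → s(j, k) ∈ C := by
          intro C hC heC
          by_contra hjC
          rw [enlarge_of_notMem hjC] at heC
          exact hv (c.blockVerts_subset ⟨e, c.subset_of_mem_independentPartition hC heC, hve⟩)
        exact ih hA hB (key hA heA) (key hB heB)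
      · exact ih hA hB (mem_of_mem_enlarge hve heA) (mem_of_mem_enlarge hve heB)
    · rw [independentPartition_add_of_not_collinear c hv hjk h] at hA hB
      have hne : s(j, v) ≠ s(k, v) := by
        intro h'
        rcases Sym2.eq_iff.1 h' with ⟨h1, -⟩ | ⟨h1, -⟩
        · exact c.ne_of_mem hjk h1
        · exact hv (h1 ▸ c.mem_left hjk)
      have hold : ∀ {C}, C ∈ c.independentPartition p → ∀ i, s(i, v) ∉ C := fun hC i hi =>
        c.notMem_edges hv i (c.subset_of_mem_independentPartition hC hi)
      rcases hA with hA | rfl | rfl <;> rcases hB with hB | rfl | rfl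
      · exact ih hA hB heA heB
      · exact absurd (heB ▸ heA) (hold hA j)
      · exact absurd (heB ▸ heA) (hold hA k)
      · exact absurd (heA ▸ heB) (hold hB j)
      · rfl
      · exact absurd (heA.symm.trans heB) hne
      · exact absurd (heA ▸ heB) (hold hB k)
      · exact absurd (heB.symm.trans heA) hne
      · rfl

theorem nonempty_of_mem_independentPartition (c : HennebergSeq S E) :
    ∀ {A : Set (Sym2 V)}, A ∈ c.independentPartition p → A.Nonempty := by
  induction c with
  | base a b hab =>
    intro A hA
    rw [independentPartition, mem_singleton_iff] at hA
    exact hA ▸ singleton_nonempty _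
  | @add S E c v j k hv hjk ih =>
    intro A hA
    by_cases h : Collinear ℝ {p j, p k, p v}
    · rw [independentPartition_add_of_collinear c hv hjk h] at hA
      obtain ⟨A, hA, rfl⟩ := hA
      exact (ih hA).mono (subset_enlarge _ _ _ _)
    · rw [independentPartition_add_of_not_collinear c hv hjk h] at hA
      rcases hA with hA | rfl | rfl
      · exact ih hA
      · exact singleton_nonempty _
      · exact singleton_nonempty _

theorem edges_nonempty (c : HennebergSeq S E) : E.Nonempty := by
  cases c with
  | base a b hab => exact singleton_nonempty _
  | add c v j k hv hjk => exact insert_nonempty _ _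

theorem independentPartition_nonempty (c : HennebergSeq S E) (p : V → Plane) :
    (c.independentPartition p).Nonempty := by
  obtain ⟨e, he⟩ := c.edges_nonempty
  obtain ⟨A, hA, -⟩ := c.exists_mem_independentPartition p he
  exact ⟨A, hA⟩

/-- Velocities that are rigid on each class of the independent partition are rigid. -/
theorem isRigidOn_of_forall_blockVerts (c : HennebergSeq S E) {u : V → Plane} :
    (∀ i j, s(i, j) ∈ E → p i ≠ p j) →
    (∀ A ∈ c.independentPartition p, IsRigidOn p (blockVerts A) u) → IsRigidOn p S u := by
  induction c with
  | base a b hab =>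
    intro _ hu
    rw [← blockVerts_singleton]
    exact hu _ rfl
  | @add S E c v j k hv hjk ih =>
    intro hp hu
    have hp' : ∀ i j, s(i, j) ∈ E → p i ≠ p j := fun i j h => hp i j (.inr (.inr h))
    have hjv : p v ≠ p j := (hp j v (.inl rfl)).symm
    have hkv : p v ≠ p k := (hp k v (.inr (.inl rfl))).symm
    by_cases h : Collinear ℝ {p j, p k, p v}
    · rw [independentPartition_add_of_collinear c hv hjk h] at hu
      obtain ⟨a, s, hrig⟩ := ih hp' fun A hA =>
        (hu _ ⟨A, hA, rfl⟩).mono fun i ⟨e, he, hi⟩ => ⟨e, subset_enlarge _ _ _ _ he, hi⟩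
      obtain ⟨A, hA, hjA⟩ := c.exists_mem_independentPartition p hjk
      obtain ⟨b, t, hb⟩ := hu _ ⟨A, hA, rfl⟩
      rw [enlarge_of_mem hjA, blockVerts_insert hjA] at hb
      -- The old vertices and the enlarged class share the distinct points `p j` and `p k`, which
      -- forces their two motions to agree.
      obtain ⟨rfl, rfl⟩ := rigid_params_unique (hp' j k hjk)
        ((hrig j (c.mem_left hjk)).symm.trans (hb j (.inr ⟨_, hjA, by simp⟩)))
        ((hrig k (c.mem_right hjk)).symm.trans (hb k (.inr ⟨_, hjA, by simp⟩)))
      refine ⟨a, s, ?_⟩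
      rintro i (rfl | hi)
      · exact hb i (.inl rfl)
      · exact hrig i hi
    · rw [independentPartition_add_of_not_collinear c hv hjk h] at hu
      obtain ⟨a, s, hrig⟩ := ih hp' fun A hA => hu A (.inl hA)
      -- Relative to the motion of the old vertices, the velocity of `v` is orthogonal to both new
      -- edges, which are linearly independent.
      have key : ∀ l, l ∈ S → p v ≠ p l → IsRigidOn p {l, v} u →
          ⟪p v - p l, u v - (a + s • rot90 (p v))⟫ = 0 := by
        intro l hl hlv hr
        rw [isRigidOn_pair_iff hlv, hrig l hl] at hr
        have e : u v - (a + s • rot90 (p v)) =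
            (u v - (a + s • rot90 (p l))) - s • rot90 (p v - p l) := by
          rw [map_sub, smul_sub]; abel
        rw [e, inner_sub_right, hr, inner_smul_right, inner_rot90_self]
        simp
      have hv0 := eq_zero_of_area_ne_zero (area_ne_zero_of_not_collinear hjv h)
        (key j (c.mem_left hjk) hjv (blockVerts_singleton j v ▸ hu _ (.inr (.inl rfl))))
        (key k (c.mem_right hjk) hkv (blockVerts_singleton k v ▸ hu _ (.inr (.inr rfl))))
      refine ⟨a, s, ?_⟩
      rintro i (rfl | hi)
      · exact sub_eq_zero.1 hv0
      · exact hrig i hi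

/-- Velocities prescribed independently on the classes of the independent partition are realized
simultaneously, up to a rigid motion of each class. -/
theorem exists_isRigidOn_sub (c : HennebergSeq S E) :
    (∀ i j, s(i, j) ∈ E → p i ≠ p j) → ∀ w : Set (Sym2 V) → V → Plane, ∃ u : V → Plane,
      ∀ A ∈ c.independentPartition p, IsRigidOn p (blockVerts A) (u - w A) := by
  classical
  induction c with
  | base a b hab =>
    intro _ w
    refine ⟨w {s(a, b)}, fun A hA => ?_⟩
    rw [independentPartition, mem_singleton_iff] at hA
    exact ⟨0, 0, fun i _ => by simp [hA]⟩
  | @add S E c v j k hv hjk ih =>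
    intro hp w
    have hp' : ∀ i j, s(i, j) ∈ E → p i ≠ p j := fun i j h => hp i j (.inr (.inr h))
    have hjv : p v ≠ p j := (hp j v (.inl rfl)).symm
    have hkv : p v ≠ p k := (hp k v (.inr (.inl rfl))).symm
    have hne : ∀ {A}, A ∈ c.independentPartition p → ∀ i ∈ blockVerts A, i ≠ v := by
      rintro A hA i ⟨e, he, hi⟩ rfl
      exact hv (c.blockVerts_subset ⟨e, c.subset_of_mem_independentPartition hA he, hi⟩)
    by_cases h : Collinear ℝ {p j, p k, p v}
    · rw [independentPartition_add_of_collinear c hv hjk h]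
      obtain ⟨u, hu⟩ := ih hp' fun A => w (enlarge v j k A)
      obtain ⟨A, hA, hjA⟩ := c.exists_mem_independentPartition p hjk
      obtain ⟨b, t, hb⟩ := hu A hA
      -- On the class containing `s(j, k)` the old solution differs from the prescribed field by the
      -- motion `(b, t)`; adding the same motion at `v` preserves this.
      refine ⟨Function.update u v (w (enlarge v j k A) v + (b + t • rot90 (p v))), ?_⟩
      rintro _ ⟨B, hB, rfl⟩
      by_cases hjB : s(j, k) ∈ B
      · obtain rfl := c.independentPartition_unique hB hA hjB hjA
        rw [enlarge_of_mem hjB, blockVerts_insert hjB, ← enlarge_of_mem hjB]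
        refine ⟨b, t, ?_⟩
        rintro i (rfl | hi)
        · simp
        · rw [Pi.sub_apply, Function.update_of_ne (hne hB i hi)]
          exact hb i hi
      · obtain ⟨b', t', hb'⟩ := hu B hB
        have hE : blockVerts (enlarge v j k B) = blockVerts B := by rw [enlarge_of_notMem hjB]
        rw [hE]
        refine ⟨b', t', fun i hi => ?_⟩
        rw [Pi.sub_apply, Function.update_of_ne (hne hB i hi)]
        exact hb' i hi
    · rw [independentPartition_add_of_not_collinear c hv hjk h]
      obtain ⟨u, hu⟩ := ih hp' w
      -- A one-edge class only prescribes the rate of change of its length, so the velocity of `v`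
      -- has to solve two independent scalar equations in the plane.
      obtain ⟨y, hyj, hyk⟩ := exists_inner_eq_of_area_ne_zero
        (area_ne_zero_of_not_collinear hjv h)
        ⟪p v - p j, u j + (w {s(j, v)} v - w {s(j, v)} j)⟫
        ⟪p v - p k, u k + (w {s(k, v)} v - w {s(k, v)} k)⟫
      have hjne : j ≠ v := fun e => hv (e ▸ c.mem_left hjk)
      have hkne : k ≠ v := fun e => hv (e ▸ c.mem_right hjk)
      refine ⟨Function.update u v y, ?_⟩
      rintro A (hA | rfl | rfl)
      · obtain ⟨b, t, hb⟩ := hu A hA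
        refine ⟨b, t, fun i hi => ?_⟩
        rw [Pi.sub_apply, Function.update_of_ne (hne hA i hi)]
        exact hb i hi
      · rw [blockVerts_singleton, isRigidOn_pair_iff hjv]
        simp only [Pi.sub_apply, Function.update_self, Function.update_of_ne hjne,
          inner_sub_right, inner_add_right] at hyj ⊢
        linarith
      · rw [blockVerts_singleton, isRigidOn_pair_iff hkv]
        simp only [Pi.sub_apply, Function.update_self, Function.update_of_ne hkne,
          inner_sub_right, inner_add_right] at hyk ⊢
        linarith

end HennebergSeq

end Partition

/-! ### Decomposition of the system into its blocks -/

section Restriction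

variable {V : Type u} {G : SimpleGraph V} {f : Sym2 V → ℝ → ℝ} {c : HennebergConstruction G} {p : V → Plane}

theorem isRigidOn_blockVerts_iff {A : Set (Sym2 V)} {u : V → Plane} :
    IsRigidOn p (blockVerts A) u ↔ ∃ a, blockConfig u A = motion (blockConfig p A) a := by
  constructor
  · rintro ⟨a, s, h⟩
    exact ⟨(a, s), funext fun i => h i i.2⟩
  · rintro ⟨a, h⟩
    exact ⟨a.1, a.2, fun i hi => congrFun h ⟨i, hi⟩⟩

theorem isRigidOn_block_iff {A : Set (Sym2 V)} {u : blockVerts A → Plane} :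
    IsRigidOn (blockConfig p A) univ u ↔ ∃ a, u = motion (blockConfig p A) a := by
  rw [isRigidOn_univ_iff]
  exact ⟨fun ⟨a, ha⟩ => ⟨a, ha.symm⟩, fun ⟨a, ha⟩ => ⟨a, ha.symm⟩⟩

theorem edge_mem_of_blockGraph {A : Set (Sym2 V)} {e : Sym2 (blockVerts A)}
    (he : e ∈ (blockGraph A).edgeSet) : e.map Subtype.val ∈ A := by
  induction e with | _ i j =>
  have h : (blockGraph A).Adj i j := he
  simp only [blockGraph, SimpleGraph.comap_adj, SimpleGraph.fromEdgeSet_adj] at h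
  exact h.1

theorem blockConfig_mem_configSpace {A : Set (Sym2 V)}
    (hA : A ∈ c.independentPartition p)
    (hp : p ∈ configSpace G) :
    blockConfig p A ∈ configSpace (blockGraph A) := by
  intro i j hij
  exact hp i j (c.subset_of_mem_independentPartition hA
    (edge_mem_of_blockGraph (e := s(i, j)) hij))

/-- Ensures that the infinitesimal motions of a block form a space of dimension three, as the
criteria for the blocks require. -/
theorem exists_blockConfig_ne {A : Set (Sym2 V)}
    (hA : A ∈ c.independentPartition p)
    (hp : p ∈ configSpace G) :
    ∃ i j, blockConfig p A i ≠ blockConfig p A j := by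
  obtain ⟨e, he⟩ := c.nonempty_of_mem_independentPartition hA
  induction e with | _ i j =>
  exact ⟨⟨i, _, he, by simp⟩, ⟨j, _, he, by simp⟩,
    hp i j (c.subset_of_mem_independentPartition hA he)⟩

/-- Velocities on one block extend to the whole system, up to a rigid motion of the block, in such
a way that all other blocks move rigidly. -/
theorem exists_extension (hp : p ∈ configSpace G) {A : Set (Sym2 V)}
    (u : blockVerts A → Plane) :
    ∃ w : V → Plane, (A ∈ c.independentPartition p →
        ∃ a, blockConfig w A = u + motion (blockConfig p A) a) ∧
      ∀ B ∈ c.independentPartition p, B ≠ A → ∃ b, blockConfig w B = motion (blockConfig p B) b := by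
  classical
  set u' : V → Plane := fun v => if h : v ∈ blockVerts A then u ⟨v, h⟩ else 0
  have hu' : blockConfig u' A = u := by
    ext1 v
    exact dif_pos v.2
  -- Prescribe the given velocities on `A` and rest on every other class.
  obtain ⟨w, hw⟩ := c.exists_isRigidOn_sub (p := p) (fun i j h => hp i j (G.mem_edgeSet.1 h))
    fun B => if B = A then u' else 0
  refine ⟨w, fun hA => ?_, fun B hB hne => ?_⟩
  · obtain ⟨a, ha⟩ := isRigidOn_blockVerts_iff.1 (hw A hA)
    refine ⟨a, ?_⟩
    rw [← ha, if_pos rfl]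
    ext1 v
    have : u v = u' v := (congrFun hu' v).symm
    simp only [Pi.add_apply, this, blockConfig, Pi.sub_apply]
    abel
  · obtain ⟨b, hb⟩ := isRigidOn_blockVerts_iff.1 (hw B hB)
    refine ⟨b, ?_⟩
    rw [← hb, if_neg hne, sub_zero]

theorem contDiffOn_blockLaw {A : Set (Sym2 V)}
    (hA : A ∈ c.independentPartition p)
    (hf : ∀ e ∈ G.edgeSet, ContDiffOn ℝ 1 (f e) (Ioi 0))
    (e : Sym2 (blockVerts A)) (he : e ∈ (blockGraph A).edgeSet) :
    ContDiffOn ℝ 1 (blockLaw f A e) (Ioi 0) :=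
  hf _ (c.subset_of_mem_independentPartition hA (edge_mem_of_blockGraph he))

theorem isRigidOn_of_forall_blockConfig (hp : p ∈ configSpace G) {u : V → Plane}
    (hu : ∀ A ∈ c.independentPartition p, IsRigidOn (blockConfig p A) univ (blockConfig u A)) :
    IsRigidOn p univ u :=
  c.isRigidOn_of_forall_blockVerts (fun i j h => hp i j (G.mem_edgeSet.1 h)) fun A hA =>
    isRigidOn_blockVerts_iff.2 (isRigidOn_block_iff.1 (hu A hA))

theorem IsRigidOn.block {u : V → Plane} (hu : IsRigidOn p univ u) (A : Set (Sym2 V)) :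
    IsRigidOn (blockConfig p A) univ (blockConfig u A) :=
  isRigidOn_block_iff.2 (isRigidOn_blockVerts_iff.1 (hu.mono (subset_univ _)))

theorem IsRigidOn.of_extension {A : Set (Sym2 V)} {u : blockVerts A → Plane} {w : V → Plane}
    (hw : ∃ a, blockConfig w A = u + motion (blockConfig p A) a) (hr : IsRigidOn p univ w) :
    IsRigidOn (blockConfig p A) univ u := by
  obtain ⟨a, ha⟩ := hw
  obtain ⟨b, hb⟩ := isRigidOn_block_iff.1 (hr.block A)
  exact isRigidOn_block_iff.2 ⟨b - a, by rw [map_sub, ← hb, ha, add_sub_cancel_right]⟩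

end Restriction

/-! ### Splitting of virtual work and Hessian form over the blocks. -/

section Blocks

variable {V : Type u} [Fintype V] {G : SimpleGraph V} {f : Sym2 V → ℝ → ℝ}

/-- Forces are central and motions preserve edge lengths to first order, so each edge does no work,
critical or not. -/
theorem virtualWork_motion (G : SimpleGraph V) (f : Sym2 V → ℝ → ℝ) (p : V → Plane)
    (a : Plane × ℝ) : virtualWork G f p (motion p a) = 0 := by
  classical
  rw [virtualWork, pairSum_congr (l := fun _ _ => 0)]
  · simp [pairSum]
  · intro i j _
    rw [motion_apply, motion_apply, add_sub_add_left_eq_sub, ← smul_sub, ← map_sub,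
      inner_smul_right, inner_rot90_self, mul_zero, mul_zero]

theorem virtualWork_add (G : SimpleGraph V) (f : Sym2 V → ℝ → ℝ) (p u w : V → Plane) :
    virtualWork G f p (u + w) = virtualWork G f p u + virtualWork G f p w := by
  simp only [← workCLM_apply, map_add]

open Classical in
theorem pairSum_blockGraph {A : Set (Sym2 V)} (hA : ∀ i j, s(i, j) ∈ A → i ≠ j)
    (k : V → V → ℝ) :
    pairSum (blockGraph A) (fun i j => k i j) =
      2⁻¹ * ∑ i, ∑ j, if s(i, j) ∈ A then k i j else 0 := by
  have hsum : ∀ g : V → ℝ, (∀ i, i ∉ blockVerts A → g i = 0) →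
      ∑ i : blockVerts A, g i = ∑ i, g i := by
    intro g hg
    rw [← Finset.sum_subtype (s := {i | i ∈ blockVerts A}) (p := fun i => i ∈ blockVerts A)
      (by simp) g, Finset.sum_filter_of_ne]
    intro i _ hi
    by_contra hn
    exact hi (hg i hn)
  have hadj : ∀ i j : blockVerts A, (blockGraph A).Adj i j ↔ s((i : V), (j : V)) ∈ A := by
    intro i j
    simp only [blockGraph, SimpleGraph.comap_adj, SimpleGraph.fromEdgeSet_adj,
      Function.Embedding.subtype_apply]
    exact ⟨fun h => h.1, fun h => ⟨h, hA _ _ h⟩⟩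
  unfold pairSum
  congr 1
  rw [← hsum (fun i => ∑ j, if s(i, j) ∈ A then k i j else 0)]
  · refine Finset.sum_congr rfl fun i _ => ?_
    rw [← hsum (fun j => if s((i : V), j) ∈ A then k i j else 0)]
    · refine Finset.sum_congr rfl fun j _ => ?_
      simp only [hadj]
    · intro j hj
      exact if_neg fun h => hj ⟨_, h, by simp⟩
  · intro i hi
    exact Finset.sum_eq_zero fun j _ => if_neg fun h => hi ⟨_, h, by simp⟩

variable (c : HennebergConstruction G) (p : V → Plane)

/-- The classes of the independent partition as a finite set. -/
def blocks : Finset (Set (Sym2 V)) := (c.independentPartition p).toFinite.toFinset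

variable {c p}

theorem mem_blocks {A : Set (Sym2 V)} : A ∈ blocks c p ↔ A ∈ c.independentPartition p := by
  simp [blocks]

variable (c p)

/-- Every edge lies in exactly one class, so its term appears exactly once on the right. -/
theorem pairSum_eq_sum_blocks (k : V → V → ℝ) :
    pairSum G k = ∑ A ∈ blocks c p, pairSum (blockGraph A) fun i j => k i j := by
  classical
  have h1 : ∀ i j, (if G.Adj i j then k i j else 0) =
      ∑ A ∈ blocks c p, if s(i, j) ∈ A then k i j else 0 := by
    intro i j
    split_ifs with h
    · obtain ⟨A, hA, hij⟩ := c.exists_mem_independentPartition p (G.mem_edgeSet.2 h)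
      rw [Finset.sum_eq_single A]
      · rw [if_pos hij]
      · intro B hB hne
        exact if_neg fun hB' => hne (c.independentPartition_unique (mem_blocks.1 hB) hA hB' hij)
      · exact fun hA' => absurd (mem_blocks.2 hA) hA'
    · refine (Finset.sum_eq_zero fun A hA => if_neg fun hij => h ?_).symm
      exact G.mem_edgeSet.1 (c.subset_of_mem_independentPartition (mem_blocks.1 hA) hij)
  rw [Finset.sum_congr rfl fun A hA => pairSum_blockGraph (fun i j hij =>
    c.ne_of_mem (c.subset_of_mem_independentPartition (mem_blocks.1 hA) hij)) k]
  unfold pairSum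
  simp only [h1]
  rw [← Finset.mul_sum]
  congr 1
  rw [Finset.sum_comm (s := blocks c p)]
  refine Finset.sum_congr rfl fun i _ => ?_
  rw [Finset.sum_comm (s := blocks c p)]

theorem virtualWork_eq_sum_blocks (f : Sym2 V → ℝ → ℝ) (u : V → Plane) :
    virtualWork G f p u = ∑ A ∈ blocks c p,
      virtualWork (blockGraph A) (blockLaw f A) (blockConfig p A) (blockConfig u A) :=
  pairSum_eq_sum_blocks c p _

theorem hessForm_eq_sum_blocks (f : Sym2 V → ℝ → ℝ) (u w : V → Plane) :
    hessForm G f p u w = ∑ A ∈ blocks c p,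
      hessForm (blockGraph A) (blockLaw f A) (blockConfig p A) (blockConfig u A)
        (blockConfig w A) :=
  pairSum_eq_sum_blocks c p _

variable {c p}

/-- Extend `u` so that the other blocks move rigidly: they do no work, and the total work is that of
the block. -/
theorem virtualWork_block_eq_zero {A : Set (Sym2 V)}
    (hA : A ∈ c.independentPartition p)
    (hp : p ∈ configSpace G) (hcrit : ∀ u, virtualWork G f p u = 0)
    (u : blockVerts A → Plane) :
    virtualWork (blockGraph A) (blockLaw f A) (blockConfig p A) u = 0 := by
  obtain ⟨w, hwA, hw⟩ := exists_extension (c := c) hp u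
  obtain ⟨a, ha⟩ := hwA hA
  have h := hcrit w
  rw [virtualWork_eq_sum_blocks c p f, Finset.sum_eq_single A] at h
  · rwa [ha, virtualWork_add, virtualWork_motion, add_zero] at h
  · intro B hB hne
    obtain ⟨b, hb⟩ := hw B (mem_blocks.1 hB) hne
    rw [hb, virtualWork_motion]
  · exact fun h => absurd (mem_blocks.2 hA) h

theorem hessForm_add_motion {p : V → Plane} (hcrit : ∀ u, virtualWork G f p u = 0)
    (u w : V → Plane) (a : Plane × ℝ) :
    hessForm G f p (u + motion p a) w = hessForm G f p u w := by
  rw [hessForm_add_left, hessForm_motion hcrit, add_zero]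

/-- An extension of a displacement of one block: its Hessian form against any other displacement
only sees the block. -/
theorem exists_extension_hessForm (hp : p ∈ configSpace G)
    (hcrit : ∀ u, virtualWork G f p u = 0) {A : Set (Sym2 V)}
    (hA : A ∈ c.independentPartition p) (u : blockVerts A → Plane) :
    ∃ w : V → Plane, (∃ a, blockConfig w A = u + motion (blockConfig p A) a) ∧
      ∀ z, hessForm G f p w z =
        hessForm (blockGraph A) (blockLaw f A) (blockConfig p A) u (blockConfig z A) := by
  obtain ⟨w, hwA, hw⟩ := exists_extension (c := c) hp u
  obtain ⟨a, ha⟩ := hwA hA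
  refine ⟨w, ⟨a, ha⟩, fun z => ?_⟩
  rw [hessForm_eq_sum_blocks c p f, Finset.sum_eq_single A]
  · rw [ha, hessForm_add_motion (virtualWork_block_eq_zero hA hp hcrit)]
  · intro B hB hne
    obtain ⟨b, hb⟩ := hw B (mem_blocks.1 hB) hne
    rw [hb, hessForm_motion (virtualWork_block_eq_zero (mem_blocks.1 hB) hp hcrit)]
  · exact fun h => absurd (mem_blocks.2 hA) h

-- Extensions of block velocities serve as radical vectors in one direction and as test vectors in
-- the other.
variable (c) in
theorem radical_iff_blocks (hp : p ∈ configSpace G) (hcrit : ∀ u, virtualWork G f p u = 0) :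
    (∀ u, (∀ w, hessForm G f p u w = 0) → IsRigidOn p univ u) ↔
      ∀ A ∈ c.independentPartition p, ∀ u,
        (∀ w, hessForm (blockGraph A) (blockLaw f A) (blockConfig p A) u w = 0) →
          IsRigidOn (blockConfig p A) univ u := by
  constructor
  · intro h A hA u hu
    obtain ⟨w, hw, hform⟩ := exists_extension_hessForm hp hcrit hA u
    exact .of_extension hw (h w fun z => by rw [hform, hu])
  · intro h u hu
    refine isRigidOn_of_forall_blockConfig (c := c) hp fun A hA => h A hA _ fun z => ?_
    obtain ⟨w, -, hform⟩ := exists_extension_hessForm hp hcrit hA z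
    rw [hessForm_comm, ← hform, hessForm_comm, hu]

-- On an extension the total form equals one block form. Conversely each block contributes a
-- nonnegative term, and a nonrigid field is nonrigid on some block, whose term is positive.
variable (c) in
theorem positive_iff_blocks (hp : p ∈ configSpace G) (hcrit : ∀ u, virtualWork G f p u = 0) :
    (∀ u, ¬ IsRigidOn p univ u → 0 < hessForm G f p u u) ↔
      ∀ A ∈ c.independentPartition p, ∀ u, ¬ IsRigidOn (blockConfig p A) univ u →
        0 < hessForm (blockGraph A) (blockLaw f A) (blockConfig p A) u u := by
  constructor
  · intro h A hA u hu
    obtain ⟨w, ⟨a, ha⟩, hform⟩ := exists_extension_hessForm hp hcrit hA u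
    have h1 := h w fun hr => hu (.of_extension ⟨a, ha⟩ hr)
    rwa [hform, ha, hessForm_comm,
      hessForm_add_motion (virtualWork_block_eq_zero hA hp hcrit)] at h1
  · intro h u hu
    have hex : ∃ A ∈ c.independentPartition p,
        ¬ IsRigidOn (blockConfig p A) univ (blockConfig u A) := by
      by_contra! hall
      exact hu (isRigidOn_of_forall_blockConfig hp hall)
    obtain ⟨A, hA, hAu⟩ := hex
    rw [hessForm_eq_sum_blocks c p f]
    refine Finset.sum_pos' (fun B hB => ?_) ⟨A, mem_blocks.2 hA, h A hA _ hAu⟩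
    by_cases hr : IsRigidOn (blockConfig p B) univ (blockConfig u B)
    · obtain ⟨b, hb⟩ := isRigidOn_block_iff.1 hr
      rw [hb, hessForm_motion (virtualWork_block_eq_zero (mem_blocks.1 hB) hp hcrit)]
    · exact (h B (mem_blocks.1 hB) _ hr).le

end Blocks

end Formation

end

/-! ### Conclusion from the Hessian criteria and the block decomposition. -/

theorem corollary3 {V : Type*} [Fintype V] (G : SimpleGraph V)
    (c : Formation.HennebergConstruction G)
    (f : Sym2 V → ℝ → ℝ) (hf : ∀ e ∈ G.edgeSet, Formation.IsInteractionLaw (f e))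
    (p : V → Formation.Plane) (hp : Formation.IsCriticalOrbit G f p) :
    (∀ A ∈ c.independentPartition p,
      Formation.IsCriticalOrbit (Formation.blockGraph A) (Formation.blockLaw f A)
        (Formation.blockConfig p A)) ∧
    (Formation.IsNondegenerate G f p ↔
      ∀ A ∈ c.independentPartition p,
        Formation.IsNondegenerate (Formation.blockGraph A) (Formation.blockLaw f A)
          (Formation.blockConfig p A)) ∧
    (Formation.IsExponentiallyStable G f p ↔
      ∀ A ∈ c.independentPartition p,
        Formation.IsExponentiallyStable (Formation.blockGraph A) (Formation.blockLaw f A)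
          (Formation.blockConfig p A)) := by
  have hC : ∀ e ∈ G.edgeSet, ContDiffOn ℝ 1 (f e) (Set.Ioi 0) := fun e he => (hf e he).contDiffOn
  obtain ⟨hcfg, hcrit⟩ := (Formation.isCriticalOrbit_iff hC).1 hp
  have hblock : ∀ A ∈ c.independentPartition p,
      Formation.IsCriticalOrbit (Formation.blockGraph A) (Formation.blockLaw f A)
        (Formation.blockConfig p A) := fun A hA =>
    (Formation.isCriticalOrbit_iff (Formation.contDiffOn_blockLaw hA hC)).2
      ⟨Formation.blockConfig_mem_configSpace hA hcfg,
        Formation.virtualWork_block_eq_zero hA hcfg hcrit⟩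
  obtain ⟨i, j, hij⟩ : ∃ i j, p i ≠ p j := by
    obtain ⟨A, hA⟩ := c.independentPartition_nonempty p
    obtain ⟨i, j, hij⟩ := Formation.exists_blockConfig_ne hA hcfg
    exact ⟨i, j, hij⟩
  refine ⟨hblock, ?_, ?_⟩
  · rw [Formation.isNondegenerate_iff hC hp hij,
      Formation.radical_iff_blocks c hcfg hcrit]
    refine forall₂_congr fun A hA => ?_
    obtain ⟨i, j, hij⟩ := Formation.exists_blockConfig_ne hA hcfg
    exact (Formation.isNondegenerate_iff (Formation.contDiffOn_blockLaw hA hC)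
      (hblock A hA) hij).symm
  · rw [Formation.isExponentiallyStable_iff hC hp hij,
      Formation.positive_iff_blocks c hcfg hcrit]
    refine forall₂_congr fun A hA => ?_
    obtain ⟨i, j, hij⟩ := Formation.exists_blockConfig_ne hA hcfg
    exact (Formation.isExponentiallyStable_iff (Formation.contDiffOn_blockLaw hA hC)
      (hblock A hA) hij).symm
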